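/- **Theorem (Online Stripe Discrepancy).** Suppose $n$ points $p_1,\dots,p_n$ arrive one by one, independently and uniformly at random in the unit square $[0,1]\times[0,1]$. On its arrival each point has to be coloured immediately and irrevocably: the algorithm knows $n$ and the points that have arrived so far and chooses $\chi(t)\in\{-1,+1\}$ for $p_t$. Let $\mathcal S$ consist of all stripes $[a,b]\times[0,1]$ and $[0,1]\times[a,b]$ with $0\le a<b\le 1$, and let $$\mathsf{disc}\;=\;\sup_{S\in\mathcal S}\Big|\sum_{t\,:\,p_t\in S}\chi(t)\Big| .$$ There are a deterministic online algorithm and a universal constant $c>0$ with the following properties. The algorithm is efficient: it is a single program, for all $n$, of a random-access machine over the natural numbers that reads the binary digits of the coordinates of each arriving point, and its total running time (logarithmic cost) on any $n$ points is at most a fixed polynomial in $n$. With high probability its discrepancy is $O(n^{c/\log\log n})$: for every $k\in\mathbb N$ there is a constant $C>0$, depending only on $k$, such that for all $n\ge 3$ $$\Pr\Big[\mathsf{disc}> C\,n^{c/\log\log n}\Big]\;\le\;\frac1{n^{k}} .$$ -/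

import Mathlib

open MeasureTheory Set

/-- Memory of a random-access machine: registers and arrays holding natural numbers, together with
two one-way input tapes carrying the not yet read binary digits of the two coordinates of the
current point. -/
structure RamState where
  reg : ℕ → ℕ
  arr : ℕ → ℕ → ℕ
  tapeX : ℕ → Fin 2
  tapeY : ℕ → Fin 2

/-- Programs of the random-access machine. Registers and arrays are named by fixed numbers, array
cells are addressed by the contents of a register. The only iteration is `loop r P`, which runs `P`
as many times as the value of register `r` on entry; so every program halts on every input. These
are special random-access machine programs, so the existence of one is the stronger claim. -/
inductive RamProg where
  | skip : RamProg
  | const (r c : ℕ) : RamProg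
  | copy (r s : ℕ) : RamProg
  | add (r s t : ℕ) : RamProg
  | sub (r s t : ℕ) : RamProg
  | mul (r s t : ℕ) : RamProg
  | div (r s t : ℕ) : RamProg
  | load (r a i : ℕ) : RamProg
  | store (a i r : ℕ) : RamProg
  | readX (r : ℕ) : RamProg
  | readY (r : ℕ) : RamProg
  | seq (P Q : RamProg) : RamProg
  | ifLt (r s : ℕ) (P Q : RamProg) : RamProg
  | loop (r : ℕ) (P : RamProg) : RamProg

namespace RamState

/-- Overwrite register `r`. -/
def setReg (s : RamState) (r v : ℕ) : RamState :=
  { s with reg := Function.update s.reg r v }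

/-- Overwrite cell `i` of array `a`. -/
def setArr (s : RamState) (a i v : ℕ) : RamState :=
  { s with arr := Function.update s.arr a (Function.update (s.arr a) i v) }

end RamState

namespace RamProg

/-- The state in which a program halts. -/
def exec : RamProg → RamState → RamState
  | skip, σ => σ
  | const r c, σ => σ.setReg r c
  | copy r s, σ => σ.setReg r (σ.reg s)
  | add r s t, σ => σ.setReg r (σ.reg s + σ.reg t)
  | sub r s t, σ => σ.setReg r (σ.reg s - σ.reg t)
  | mul r s t, σ => σ.setReg r (σ.reg s * σ.reg t)
  | div r s t, σ => σ.setReg r (σ.reg s / σ.reg t)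
  | load r a i, σ => σ.setReg r (σ.arr a (σ.reg i))
  | store a i r, σ => σ.setArr a (σ.reg i) (σ.reg r)
  | readX r, σ => { σ.setReg r (σ.tapeX 0) with tapeX := fun j => σ.tapeX (j + 1) }
  | readY r, σ => { σ.setReg r (σ.tapeY 0) with tapeY := fun j => σ.tapeY (j + 1) }
  | seq P Q, σ => exec Q (exec P σ)
  | ifLt r s P Q, σ => if σ.reg r < σ.reg s then exec P σ else exec Q σ
  | loop r P, σ => (exec P)^[σ.reg r] σ

/-- The running time of a program under the logarithmic cost criterion: every elementary operation
is charged one unit plus the binary lengths of the numbers and addresses that it handles. -/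
def time : RamProg → RamState → ℕ
  | skip, _ => 1
  | const _ c, _ => 1 + c.size
  | copy _ s, σ => 1 + (σ.reg s).size
  | add _ s t, σ => 1 + (σ.reg s).size + (σ.reg t).size
  | sub _ s t, σ => 1 + (σ.reg s).size + (σ.reg t).size
  | mul _ s t, σ => 1 + (σ.reg s).size + (σ.reg t).size
  | div _ s t, σ => 1 + (σ.reg s).size + (σ.reg t).size
  | load _ a i, σ => 1 + (σ.reg i).size + (σ.arr a (σ.reg i)).size
  | store _ i r, σ => 1 + (σ.reg i).size + (σ.reg r).size
  | readX _, _ => 1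
  | readY _, _ => 1
  | seq P Q, σ => time P σ + time Q (exec P σ)
  | ifLt r s P Q, σ =>
      1 + (σ.reg r).size + (σ.reg s).size + if σ.reg r < σ.reg s then time P σ else time Q σ
  | loop r P, σ =>
      1 + (σ.reg r).size +
        ∑ i ∈ Finset.range (σ.reg r), (1 + (σ.reg r).size + time P ((exec P)^[i] σ))

end RamProg

/-- A deterministic uniform online algorithm for colouring points of the plane: `init` is run once,
knowing only the number `n` of points; `step` is run on each arrival. -/
structure OnlineAlg where
  init : RamProg
  step : RamProg

namespace OnlineAlg

/-- The memory before anything is run: register `0` holds `n`, everything else is zero. -/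
def start (n : ℕ) : RamState where
  reg := fun r => if r = 0 then n else 0
  arr := fun _ _ => 0
  tapeX := fun _ => 0
  tapeY := fun _ => 0

/-- Arrival of the point `z`: the input tapes now carry the binary digits (after the point) of the
two coordinates of `z`; the rest of the memory is kept. -/
noncomputable def feed (z : ℝ × ℝ) (σ : RamState) : RamState :=
  { σ with tapeX := Real.digits z.1 2, tapeY := Real.digits z.2 2 }

/-- The memory after the points of the list `l` have arrived in this order, when `n` points are
announced. -/
noncomputable def stateAfter (A : OnlineAlg) (n : ℕ) (l : List (ℝ × ℝ)) : RamState :=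
  l.foldl (fun σ z => A.step.exec (feed z σ)) (A.init.exec (start n))

/-- The colour given to the `t`-th point (counted from `0`). It is read off register `1` right after
the `t`-th arrival has been processed, so it depends only on the points that have arrived. -/
noncomputable def color (A : OnlineAlg) {n : ℕ} (p : Fin n → ℝ × ℝ) (t : Fin n) : ℤ :=
  if (A.stateAfter n ((List.ofFn p).take (t + 1))).reg 1 = 0 then -1 else 1

/-- The total running time on the points `p 0, …, p (n - 1)`. -/
noncomputable def runTime (A : OnlineAlg) {n : ℕ} (p : Fin n → ℝ × ℝ) : ℕ :=
  A.init.time (start n) +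
    ∑ t : Fin n, A.step.time (feed (p t) (A.stateAfter n ((List.ofFn p).take t)))

/-- The total running time is at most polynomial in the number of points, on every input. -/
def IsPolyTime (A : OnlineAlg) : Prop :=
  ∃ q : Polynomial ℕ, ∀ (n : ℕ) (p : Fin n → ℝ × ℝ), A.runTime p ≤ q.eval n

end OnlineAlg

/-- The vertical and horizontal stripes of the unit square. -/
def stripes : Set (Set (ℝ × ℝ)) :=
  {S | ∃ a b : ℝ, 0 ≤ a ∧ a < b ∧ b ≤ 1 ∧
    (S = Icc a b ×ˢ Icc 0 1 ∨ S = Icc 0 1 ×ˢ Icc a b)}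

open scoped Classical in
/-- The imbalance of a set `S` under the colouring `χ` of the points `p`. -/
noncomputable def imbalance {n : ℕ} (p : Fin n → ℝ × ℝ) (χ : Fin n → ℤ) (S : Set (ℝ × ℝ)) : ℤ :=
  ∑ t : Fin n, if p t ∈ S then χ t else 0

/-- The discrepancy of the colouring `χ` of the points `p` with respect to all stripes. -/
noncomputable def stripeDisc {n : ℕ} (p : Fin n → ℝ × ℝ) (χ : Fin n → ℤ) : ℝ :=
  ⨆ S : stripes, |(imbalance p χ S : ℝ)|

/-- The supremum in `stripeDisc` is over a bounded set. -/
theorem bddAbove_imbalance {n : ℕ} (p : Fin n → ℝ × ℝ) (χ : Fin n → ℤ) :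
    BddAbove (range fun S : stripes => |(imbalance p χ S : ℝ)|) := by
  refine ⟨∑ t, |(χ t : ℝ)|, ?_⟩
  rintro _ ⟨S, rfl⟩
  simp only [imbalance]
  push_cast
  refine (Finset.abs_sum_le_sum_abs _ _).trans (Finset.sum_le_sum fun t _ => ?_)
  split_ifs <;> simp

/-- The law of `n` independent uniform points of the unit square. -/
noncomputable def uniformPoints (n : ℕ) : Measure (Fin n → ℝ × ℝ) :=
  Measure.pi fun _ => (volume : Measure (ℝ × ℝ)).restrict (Icc 0 1 ×ˢ Icc 0 1)

/-! Let `m = Nat.clog 2 n` and cut each axis into `2 ^ m` equal intervals, the leaves of two dyadic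
trees. The colouring is followed through its Haar coefficients `d v`, one for each inner node of the
two trees, and its total sum, kept at a common root. If all of them are at most `T` in absolute
value, every dyadic interval has imbalance at most `T`, every union of initial leaves at most `(m +
1) * T`, and a stripe differs from a difference of two such unions only in two boundary leaves,
which with high probability contain `O(m)` points each (`stripeDisc_le`).

The coefficients are controlled by the potential `∑ v, (r ^ d v + r ^ (-d v))` with `r = (m + 1) /
m`. A point touches one node on each of `2 * m + 1` levels, and its colour is chosen so that the
first-order change is `-|gradient|`. For a uniformly random cell, Haar functions of different levels
are orthogonal; by duality the mean of `|gradient|` is at least the mean of `∑ |slope|` divided by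
`2 * m + 1` (`sum_abs_le_card_mul_sum_abs`). For this `r` the first-order coefficient is exactly `2
* m + 1` times the second-order one, so the two cancel up to a bounded term and the expected
potential grows by at most `2` per point (`sum_potential_next_le`). Markov's inequality then allows
`T = m * (m * (k + 4))`, whence a discrepancy of order `(log n) ^ 3`, which is below the required
bound.

The machine decides the sign of the gradient exactly: after multiplication by `((m + 1) * m) ^ n`
all powers of `r` that occur are integers, stored in a table. Their binary lengths stay polynomial,
and so does the running time (`alg_isPolyTime`). -/

namespace RamProg

/-! ### Running time of programs with guarded loops and products. -/

/-- The registers that a program may overwrite. -/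
def writes : RamProg → Finset ℕ
  | skip => ∅
  | const r _ => {r}
  | copy r _ => {r}
  | add r _ _ => {r}
  | sub r _ _ => {r}
  | mul r _ _ => {r}
  | div r _ _ => {r}
  | load r _ _ => {r}
  | store _ _ _ => ∅
  | readX r => {r}
  | readY r => {r}
  | seq P Q => P.writes ∪ Q.writes
  | ifLt _ _ P Q => P.writes ∪ Q.writes
  | loop _ P => P.writes

/-- The arrays that a program may modify. -/
def stores : RamProg → Finset ℕ
  | store a _ _ => {a}
  | seq P Q => P.stores ∪ Q.stores
  | ifLt _ _ P Q => P.stores ∪ Q.stores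
  | loop _ P => P.stores
  | _ => ∅

/-- Every loop counter and the right factor of every multiplication is a register of `R`. -/
def GuardedBy (R : Finset ℕ) : RamProg → Prop
  | mul _ _ t => t ∈ R
  | seq P Q => P.GuardedBy R ∧ Q.GuardedBy R
  | ifLt _ _ P Q => P.GuardedBy R ∧ Q.GuardedBy R
  | loop r P => r ∈ R ∧ P.GuardedBy R
  | _ => True

/-- A bound for the number of operations and for the growth of the binary lengths, as a polynomial
in a bound for the guarding registers. -/
noncomputable def cost : RamProg → Polynomial ℕ
  | const _ c => 1 + Polynomial.C c.size
  | mul _ _ _ => 1 + Polynomial.X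
  | seq P Q => P.cost + Q.cost
  | ifLt _ _ P Q => 1 + P.cost + Q.cost
  | loop _ P => 1 + Polynomial.X * (1 + P.cost)
  | _ => 1

theorem exec_reg_of_notMem_writes {P : RamProg} {r : ℕ} (h : r ∉ P.writes) (σ : RamState) :
    (P.exec σ).reg r = σ.reg r := by
  induction P generalizing σ with
  | seq P Q ihP ihQ =>
    simp only [writes, Finset.mem_union, not_or] at h
    simp only [exec]
    rw [ihQ h.2, ihP h.1]
  | ifLt a b P Q ihP ihQ =>
    simp only [writes, Finset.mem_union, not_or] at h
    simp only [exec]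
    split_ifs
    · exact ihP h.1 σ
    · exact ihQ h.2 σ
  | loop a P ih =>
    simp only [exec]
    generalize σ.reg a = k
    induction k with
    | zero => rfl
    | succ k ihk => rw [Function.iterate_succ_apply', ih h, ihk]
  | skip => rfl
  | store a i r => rfl
  | _ => simp_all [writes, exec, RamState.setReg]

theorem exec_arr_of_notMem_stores {P : RamProg} {a : ℕ} (h : a ∉ P.stores) (σ : RamState) :
    (P.exec σ).arr a = σ.arr a := by
  induction P generalizing σ with
  | seq P Q ihP ihQ =>
    simp only [stores, Finset.mem_union, not_or] at h
    simp only [exec]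
    rw [ihQ h.2, ihP h.1]
  | ifLt a b P Q ihP ihQ =>
    simp only [stores, Finset.mem_union, not_or] at h
    simp only [exec]
    split_ifs
    · exact ihP h.1 σ
    · exact ihQ h.2 σ
  | loop b P ih =>
    simp only [exec]
    generalize σ.reg b = k
    induction k with
    | zero => rfl
    | succ k ihk => rw [Function.iterate_succ_apply', ih h, ihk]
  | store b i r => simp_all [stores, exec, RamState.setArr]
  | _ => rfl

theorem iterate_exec_reg_of_notMem_writes {P : RamProg} {r : ℕ} (h : r ∉ P.writes) (k : ℕ)
    (σ : RamState) : ((exec P)^[k] σ).reg r = σ.reg r := by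
  induction k with
  | zero => rfl
  | succ k ih => rw [Function.iterate_succ_apply', exec_reg_of_notMem_writes h, ih]

theorem iterate_exec_arr_of_notMem_stores {P : RamProg} {a : ℕ} (h : a ∉ P.stores) (k : ℕ)
    (σ : RamState) : ((exec P)^[k] σ).arr a = σ.arr a := by
  induction k with
  | zero => rfl
  | succ k ih => rw [Function.iterate_succ_apply', exec_arr_of_notMem_stores h, ih]

end RamProg

namespace RamState

/-- All numbers in the memory have at most `s` binary digits. -/
def SizeLE (σ : RamState) (s : ℕ) : Prop :=
  (∀ r, (σ.reg r).size ≤ s) ∧ ∀ a i, (σ.arr a i).size ≤ s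

theorem SizeLE.mono {σ : RamState} {s t : ℕ} (h : σ.SizeLE s) (hst : s ≤ t) : σ.SizeLE t :=
  ⟨fun r => (h.1 r).trans hst, fun a i => (h.2 a i).trans hst⟩

theorem SizeLE.setReg {σ : RamState} {s v : ℕ} (h : σ.SizeLE s) (r : ℕ) (hv : v.size ≤ s) :
    (σ.setReg r v).SizeLE s := by
  refine ⟨fun q => ?_, h.2⟩
  simp only [RamState.setReg, Function.update_apply]
  split_ifs
  exacts [hv, h.1 q]

theorem SizeLE.setArr {σ : RamState} {s v : ℕ} (h : σ.SizeLE s) (a i : ℕ) (hv : v.size ≤ s) :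
    (σ.setArr a i v).SizeLE s := by
  refine ⟨h.1, fun b j => ?_⟩
  simp only [RamState.setArr, Function.update_apply]
  split_ifs with hb
  · simp only [Function.update_apply]
    split_ifs
    exacts [hv, h.2 a j]
  · exact h.2 b j

end RamState

theorem Nat.size_add_le {x y s : ℕ} (hx : x.size ≤ s) (hy : y.size ≤ s) :
    (x + y).size ≤ s + 1 := by
  rw [Nat.size_le] at *
  rw [pow_succ]
  omega

theorem Nat.size_mul_le {x y s t : ℕ} (hx : x.size ≤ s) (hy : y.size ≤ t) :
    (x * y).size ≤ s + t := by
  rw [Nat.size_le] at *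
  rw [pow_add]
  exact Nat.mul_lt_mul'' hx hy

theorem Nat.size_le_self (x : ℕ) : x.size ≤ x := Nat.size_le.2 Nat.lt_two_pow_self

namespace RamProg

/-- Repeated squaring would make binary lengths grow exponentially. Here loop counters and right
factors sit in registers that are never written, so they stay at most `b`: a product adds at most
`b` digits, a loop makes at most `b` rounds, and lengths grow only additively. -/
theorem sizeLE_exec_and_time_le {R : Finset ℕ} {b : ℕ} {P : RamProg} (hP : P.GuardedBy R)
    (hw : Disjoint R P.writes) {σ : RamState} {s : ℕ} (hs : 1 ≤ s) (hσ : σ.SizeLE s)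
    (hb : ∀ r ∈ R, σ.reg r ≤ b) :
    (P.exec σ).SizeLE (s + P.cost.eval b) ∧
      P.time σ ≤ P.cost.eval b * (1 + 2 * (s + P.cost.eval b)) := by
  induction P generalizing σ s with
  | skip => exact ⟨hσ.mono (by simp), by simp [time, cost]⟩
  | const r c =>
    simp only [exec, time, cost, Polynomial.eval_add, Polynomial.eval_one, Polynomial.eval_C]
    exact ⟨(hσ.mono (by omega)).setReg r (by omega), by nlinarith⟩
  | copy r q =>
    have := hσ.1 q
    simp only [exec, time, cost, Polynomial.eval_one]
    exact ⟨(hσ.mono (by omega)).setReg r (by omega), by omega⟩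
  | add r q t =>
    have h1 := hσ.1 q
    have h2 := hσ.1 t
    simp only [exec, time, cost, Polynomial.eval_one]
    exact ⟨(hσ.mono (by omega)).setReg r (Nat.size_add_le h1 h2), by omega⟩
  | sub r q t =>
    have h1 := hσ.1 q
    have h2 := hσ.1 t
    simp only [exec, time, cost, Polynomial.eval_one]
    exact ⟨(hσ.mono (by omega)).setReg r
      ((Nat.size_le_size (Nat.sub_le _ _)).trans (by omega)), by omega⟩
  | mul r q t =>
    have h1 := hσ.1 q
    have h2 := hσ.1 t
    have h3 := (Nat.size_le_self (σ.reg t)).trans (hb t hP)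
    simp only [exec, time, cost, Polynomial.eval_add, Polynomial.eval_one, Polynomial.eval_X]
    exact ⟨(hσ.mono (by omega)).setReg r ((Nat.size_mul_le h1 h3).trans (by omega)),
      by nlinarith⟩
  | div r q t =>
    have h1 := hσ.1 q
    have h2 := hσ.1 t
    simp only [exec, time, cost, Polynomial.eval_one]
    exact ⟨(hσ.mono (by omega)).setReg r
      ((Nat.size_le_size (Nat.div_le_self _ _)).trans (by omega)), by omega⟩
  | load r a i =>
    have h1 := hσ.1 i
    have h2 := hσ.2 a (σ.reg i)
    simp only [exec, time, cost, Polynomial.eval_one]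
    exact ⟨(hσ.mono (by omega)).setReg r (by omega), by omega⟩
  | store a i r =>
    have h1 := hσ.1 i
    have h2 := hσ.1 r
    simp only [exec, time, cost, Polynomial.eval_one]
    exact ⟨(hσ.mono (by omega)).setArr a _ (by omega), by omega⟩
  | readX r =>
    simp only [exec, time, cost, Polynomial.eval_one]
    exact ⟨(hσ.mono (by omega)).setReg r ((Nat.size_le_self _).trans
      (by have := (σ.tapeX 0).isLt; omega)), by omega⟩
  | readY r =>
    simp only [exec, time, cost, Polynomial.eval_one]
    exact ⟨(hσ.mono (by omega)).setReg r ((Nat.size_le_self _).trans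
      (by have := (σ.tapeY 0).isLt; omega)), by omega⟩
  | seq P Q ihP ihQ =>
    simp only [writes, Finset.disjoint_union_right] at hw
    simp only [exec, time, cost, Polynomial.eval_add]
    obtain ⟨h1, h2⟩ := ihP hP.1 hw.1 hs hσ hb
    obtain ⟨h3, h4⟩ := ihQ hP.2 hw.2 (le_add_right hs) h1 fun r hr =>
      (exec_reg_of_notMem_writes (Finset.disjoint_left.1 hw.1 hr) σ).trans_le (hb r hr)
    exact ⟨h3.mono (by omega), by nlinarith⟩
  | ifLt q t P Q ihP ihQ =>
    simp only [writes, Finset.disjoint_union_right] at hw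
    simp only [exec, time, cost, Polynomial.eval_add, Polynomial.eval_one]
    obtain ⟨h1, h2⟩ := ihP hP.1 hw.1 hs hσ hb
    obtain ⟨h3, h4⟩ := ihQ hP.2 hw.2 hs hσ hb
    have h5 := hσ.1 q
    have h6 := hσ.1 t
    split_ifs
    · exact ⟨h1.mono (by omega), by nlinarith⟩
    · exact ⟨h3.mono (by omega), by nlinarith⟩
  | loop q P ih =>
    simp only [exec, time, cost, Polynomial.eval_add, Polynomial.eval_one, Polynomial.eval_mul,
      Polynomial.eval_X]
    have hq := hb q hP.1
    replace hw : Disjoint R P.writes := hw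
    have h1 := hσ.1 q
    set k := σ.reg q
    set c := P.cost.eval b
    have hregs : ∀ i, ∀ r ∈ R, ((exec P)^[i] σ).reg r ≤ b := fun i r hr =>
      (iterate_exec_reg_of_notMem_writes (Finset.disjoint_left.1 hw hr) i σ).trans_le (hb r hr)
    have hsize : ∀ i, ((exec P)^[i] σ).SizeLE (s + i * c) := by
      intro i
      induction i with
      | zero => simpa using hσ
      | succ i ihi =>
        rw [Function.iterate_succ_apply']
        exact (ih hP.2 hw (le_add_right hs) ihi (hregs i)).1.mono (by rw [Nat.succ_mul]; omega)
    have hkc : k * c ≤ b * c := Nat.mul_le_mul_right c hq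
    refine ⟨(hsize k).mono (by nlinarith), ?_⟩
    set A := 1 + 2 * (s + (1 + b * (1 + c))) with hA
    have hterm : ∀ i ∈ Finset.range k, 1 + k.size + time P ((exec P)^[i] σ) ≤ (1 + c) * A := by
      intro i hi
      have h2 := (ih hP.2 hw (le_add_right hs) (hsize i) (hregs i)).2
      have hi' : (i + 1) * c ≤ b * c :=
        Nat.mul_le_mul_right c ((Finset.mem_range.1 hi).trans_le hq)
      have h3 : c * (1 + 2 * (s + i * c + c)) ≤ c * A := by
        apply Nat.mul_le_mul_left
        rw [hA]
        nlinarith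
      have h4 : 1 + k.size ≤ A := by omega
      calc _ ≤ A + c * A := by
            have : time P ((exec P)^[i] σ) ≤ c * A := h2.trans h3
            omega
        _ = _ := by ring
    have hsum := Finset.sum_le_card_nsmul _ _ _ hterm
    rw [Finset.card_range, smul_eq_mul] at hsum
    have h5 : k * ((1 + c) * A) ≤ b * ((1 + c) * A) := Nat.mul_le_mul_right _ hq
    have h6 : 1 + k.size ≤ A := by omega
    calc _ ≤ A + b * ((1 + c) * A) := by omega
      _ = _ := by ring

end RamProg

/-! ### Haar functions on a pair of dyadic trees -/

namespace Haar

/-- The pairs of leaves reached by a point: the nodes of both trees share one heap, in which the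
first tree hangs below node `2` and the second one below node `3`. -/
def cells (m : ℕ) : Finset (ℕ × ℕ) :=
  Finset.Ico (2 * 2 ^ m) (3 * 2 ^ m) ×ˢ Finset.Ico (3 * 2 ^ m) (4 * 2 ^ m)

/-- The levels of the first tree, topped by the common root, and those of the second tree. -/
def levels (m : ℕ) : Finset (ℕ ⊕ ℕ) := (Finset.range (m + 1)).disjSum (Finset.range m)

/-- The node of a given level above a pair of leaves. -/
def node : ℕ ⊕ ℕ → ℕ × ℕ → ℕ
  | .inl i, z => z.1 / 2 ^ (i + 1)
  | .inr j, z => z.2 / 2 ^ (j + 1)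

/-- The sign belonging to the binary digit number `i` of `w`. -/
def bitSign (w i : ℕ) : ℤ := if w / 2 ^ i % 2 = 0 then 1 else -1

/-- Whether a pair of leaves lies in the left or in the right half of its node. -/
def side : ℕ ⊕ ℕ → ℕ × ℕ → ℤ
  | .inl i, z => bitSign z.1 i
  | .inr j, z => bitSign z.2 j

/-- The value at `z` of the Haar function of the node `v`. -/
def haar (m : ℕ) (z : ℕ × ℕ) (v : ℕ) : ℤ :=
  ∑ l ∈ levels m, if node l z = v then side l z else 0

theorem mem_cells {m : ℕ} {z : ℕ × ℕ} :
    z ∈ cells m ↔ z.1 / 2 ^ m = 2 ∧ z.2 / 2 ^ m = 3 := by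
  have h : 0 < 2 ^ m := by positivity
  simp only [cells, Finset.mem_product, Finset.mem_Ico, Nat.div_eq_iff h]
  omega

theorem card_cells (m : ℕ) : (cells m).card = 2 ^ m * 2 ^ m := by
  simp only [cells, Finset.card_product, Nat.card_Ico]
  congr 1 <;> omega

theorem bitSign_eq_or (w i : ℕ) : bitSign w i = 1 ∨ bitSign w i = -1 := by
  unfold bitSign
  split_ifs <;> simp

theorem side_eq_or (l : ℕ ⊕ ℕ) (z : ℕ × ℕ) : side l z = 1 ∨ side l z = -1 := by
  cases l <;> exact bitSign_eq_or _ _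

theorem div_two_pow_xor {w i j : ℕ} (h : i < j) : (w ^^^ 2 ^ i) / 2 ^ j = w / 2 ^ j := by
  rw [← Nat.shiftRight_eq_div_pow, ← Nat.shiftRight_eq_div_pow]
  apply Nat.eq_of_testBit_eq
  intro k
  have : i ≠ j + k := by omega
  simp [Nat.testBit_shiftRight, Nat.testBit_xor, this]

theorem bitSign_xor_of_lt {w i j : ℕ} (h : i < j) : bitSign (w ^^^ 2 ^ i) j = bitSign w j := by
  rw [bitSign, bitSign, div_two_pow_xor h]

theorem bitSign_eq_testBit (w i : ℕ) : bitSign w i = if w.testBit i then -1 else 1 := by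
  rw [bitSign, Nat.testBit_eq_decide_div_mod_eq]
  rcases Nat.mod_two_eq_zero_or_one (w / 2 ^ i) with h | h <;> simp [h]

theorem bitSign_xor_self (w i : ℕ) : bitSign (w ^^^ 2 ^ i) i = -bitSign w i := by
  rw [bitSign_eq_testBit, bitSign_eq_testBit, Nat.testBit_xor, Nat.testBit_two_pow]
  cases w.testBit i <;> simp

theorem log_leaf {m t w : ℕ} (hw : w / 2 ^ m = t) (ht : t = 2 ∨ t = 3) : Nat.log 2 w = m + 1 := by
  have h : 0 < 2 ^ m := by positivity
  rw [Nat.div_eq_iff h] at hw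
  have : 2 ^ (m + 1) = 2 * 2 ^ m := by ring
  have : 2 ^ (m + 1 + 1) = 4 * 2 ^ m := by ring
  rw [Nat.log_eq_iff (by simp)]
  rcases ht with rfl | rfl <;> omega

theorem log_div_two_pow (w i : ℕ) : Nat.log 2 (w / 2 ^ i) = Nat.log 2 w - i := by
  induction i with
  | zero => simp
  | succ i ih => rw [pow_succ, ← Nat.div_div_eq_div_mul, Nat.log_div_base, ih]; omega

/-- Different levels have different nodes. -/
theorem level_eq_of_node_eq {m : ℕ} {l l' : ℕ ⊕ ℕ} {z z' : ℕ × ℕ} (hl : l ∈ levels m)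
    (hl' : l' ∈ levels m) (hz : z ∈ cells m) (hz' : z' ∈ cells m) (h : node l z = node l' z') :
    l = l' := by
  rw [mem_cells] at hz hz'
  -- Equal nodes have equal depth, so `i = j`; then their ancestor at height `m` would be both `2`
  -- and `3`. The root, at height `m + 1`, is a level of the first tree only.
  have key : ∀ i j w w' : ℕ, i < m + 1 → j < m → w / 2 ^ m = 2 → w' / 2 ^ m = 3 →
      w / 2 ^ (i + 1) ≠ w' / 2 ^ (j + 1) := by
    intro i j w w' hi hj hw hw' he
    have h1 := congrArg (Nat.log 2) he
    rw [log_div_two_pow, log_div_two_pow, log_leaf hw (.inl rfl), log_leaf hw' (.inr rfl)] at h1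
    obtain rfl : i = j := by omega
    have h2 : w / 2 ^ m = w' / 2 ^ m := by
      obtain ⟨q, rfl⟩ := Nat.exists_eq_add_of_lt hj
      rw [show i + q + 1 = i + 1 + q by ring, pow_add, ← Nat.div_div_eq_div_mul,
        ← Nat.div_div_eq_div_mul, he]
    omega
  have h1 := congrArg (Nat.log 2) h
  rcases l with i | i <;> rcases l' with j | j <;>
    simp only [levels, Finset.inl_mem_disjSum, Finset.inr_mem_disjSum, Finset.mem_range]
      at hl hl' <;>
    simp only [node] at h h1
  · rw [log_div_two_pow, log_div_two_pow, log_leaf hz.1 (.inl rfl),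
      log_leaf hz'.1 (.inl rfl)] at h1
    congr 1
    omega
  · exact absurd h (key _ _ _ _ hl hl' hz.1 hz'.2)
  · exact absurd h.symm (key _ _ _ _ hl' hl hz'.1 hz.2)
  · rw [log_div_two_pow, log_div_two_pow, log_leaf hz.2 (.inr rfl),
      log_leaf hz'.2 (.inr rfl)] at h1
    congr 1
    omega

theorem haar_node {m : ℕ} {l : ℕ ⊕ ℕ} {z z' : ℕ × ℕ} (hl : l ∈ levels m)
    (hz : z ∈ cells m) (hz' : z' ∈ cells m) :
    haar m z (node l z') = if node l z = node l z' then side l z else 0 := by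
  unfold haar
  apply Finset.sum_eq_single_of_mem l hl
  intro l' hl' hne
  rw [if_neg]
  exact fun h => hne (level_eq_of_node_eq hl' hl hz hz' h)

theorem abs_haar_le_one {m : ℕ} {z : ℕ × ℕ} (hz : z ∈ cells m) (v : ℕ) : |haar m z v| ≤ 1 := by
  by_cases h : ∃ l ∈ levels m, node l z = v
  · obtain ⟨l, hl, rfl⟩ := h
    rw [haar_node hl hz hz, if_pos rfl]
    rcases side_eq_or l z with h | h <;> simp [h]
  · push Not at h
    rw [haar, Finset.sum_eq_zero fun l hl => if_neg (h l hl)]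
    simp

theorem node_lt {m : ℕ} {l : ℕ ⊕ ℕ} {z : ℕ × ℕ} (hz : z ∈ cells m) :
    node l z < 2 ^ (m + 1) := by
  simp only [cells, Finset.mem_product, Finset.mem_Ico] at hz
  have h4 : 2 ^ (m + 1) = 2 * 2 ^ m := by ring
  have key : ∀ w i, w < 4 * 2 ^ m → w / 2 ^ (i + 1) < 2 ^ (m + 1) := by
    intro w i hw
    rw [pow_succ', ← Nat.div_div_eq_div_mul]
    exact (Nat.div_le_self _ _).trans_lt (by omega)
  rcases l with i | j
  · exact key _ _ (by omega)
  · exact key _ _ (by omega)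

/-- Haar functions of different levels are orthogonal. -/
theorem sum_side_mul_side_eq_zero {m : ℕ} {l l' : ℕ ⊕ ℕ} (hl : l ∈ levels m) (hl' : l' ∈ levels m)
    (hne : l ≠ l') (a b : ℕ → ℝ) :
    ∑ z ∈ cells m, (side l z * a (node l z)) * (side l' z * b (node l' z)) = 0 := by
  have key : ∀ F : ℕ × ℕ → ℝ, ∀ e : ℕ × ℕ → ℕ × ℕ, (∀ z, e (e z) = z) →
      (∀ z ∈ cells m, e z ∈ cells m) → (∀ z, F (e z) = -F z) → ∑ z ∈ cells m, F z = 0 := by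
    intro F e he hm hF
    have h : ∑ z ∈ cells m, F z = ∑ z ∈ cells m, F (e z) :=
      (Finset.sum_nbij' e e hm hm (fun z _ => he z) (fun z _ => he z) (fun z _ => by rw [he]))
    simp only [hF, Finset.sum_neg_distrib] at h
    linarith
  have flipX : ∀ i < m, ∀ z ∈ cells m, (z.1 ^^^ 2 ^ i, z.2) ∈ cells m := by
    intro i hi z hz
    rw [mem_cells] at hz ⊢
    rwa [div_two_pow_xor hi]
  have flipY : ∀ i < m, ∀ z ∈ cells m, (z.1, z.2 ^^^ 2 ^ i) ∈ cells m := by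
    intro i hi z hz
    rw [mem_cells] at hz ⊢
    rwa [div_two_pow_xor hi]
  -- Flipping one bit negates one of the two sides and preserves the rest: the finer bit for levels
  -- of the same tree, the bit of the second coordinate for levels of different trees. The latter
  -- choice matters for `inl m`, whose bit cannot be flipped inside `cells m`.
  wlog H : (∃ i j, l = .inl i ∧ l' = .inl j ∧ i < j) ∨ (∃ i j, l = .inr i ∧ l' = .inr j ∧ i < j) ∨
      ∃ i j, l = .inr i ∧ l' = .inl j generalizing l l' a b
  · have := this hl' hl hne.symm b a (by
      rcases l with i | i <;> rcases l' with j | j <;> simp at hne H ⊢ <;> omega)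
    rw [← this]
    exact Finset.sum_congr rfl fun z _ => mul_comm _ _
  rcases H with ⟨i, j, rfl, rfl, hij⟩ | ⟨i, j, rfl, rfl, hij⟩ | ⟨i, j, rfl, rfl⟩ <;>
    simp only [levels, Finset.inl_mem_disjSum, Finset.inr_mem_disjSum, Finset.mem_range]
      at hl hl'
  · refine key _ (fun z => (z.1 ^^^ 2 ^ i, z.2)) (fun z => by simp)
      (flipX i (by omega)) fun z => ?_
    simp only [side, node, bitSign_xor_self, bitSign_xor_of_lt hij,
      div_two_pow_xor (Nat.lt_succ_self i), div_two_pow_xor (hij.trans (Nat.lt_succ_self j))]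
    push_cast
    ring
  · refine key _ (fun z => (z.1, z.2 ^^^ 2 ^ i)) (fun z => by simp)
      (flipY i (by omega)) fun z => ?_
    simp only [side, node, bitSign_xor_self, bitSign_xor_of_lt hij,
      div_two_pow_xor (Nat.lt_succ_self i), div_two_pow_xor (hij.trans (Nat.lt_succ_self j))]
    push_cast
    ring
  · refine key _ (fun z => (z.1, z.2 ^^^ 2 ^ i)) (fun z => by simp)
      (flipY i (by omega)) fun z => ?_
    simp only [side, node, bitSign_xor_self, div_two_pow_xor (Nat.lt_succ_self i)]
    push_cast
    ring

/-- A lower bound for the `L¹` norm of a Haar polynomial, by duality. -/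
theorem sum_abs_le_card_mul_sum_abs (m : ℕ) (g : ℕ → ℝ) :
    ∑ z ∈ cells m, ∑ l ∈ levels m, |g (node l z)| ≤
      (2 * m + 1) * ∑ z ∈ cells m, |∑ l ∈ levels m, side l z * g (node l z)| := by
  -- The Haar polynomial with coefficients `sign g` serves as test function: it is bounded by the
  -- number of levels, and by orthogonality its pairing with the given polynomial is the sum of all
  -- `|g|`.
  set s : ℕ → ℝ := fun v => SignType.sign (g v)
  have hs : ∀ v, |s v| ≤ 1 := by
    intro v
    simp only [s]
    rcases lt_trichotomy (g v) 0 with h | h | h <;> simp [h]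
  have hside : ∀ l z, |(side l z : ℝ)| = 1 := by
    intro l z
    rcases side_eq_or l z with h | h <;> simp [h]
  have hdual : ∀ z, |∑ l ∈ levels m, side l z * s (node l z)| ≤ 2 * m + 1 := by
    intro z
    calc _ ≤ ∑ l ∈ levels m, |side l z * s (node l z)| := Finset.abs_sum_le_sum_abs _ _
      _ ≤ ∑ l ∈ levels m, (1 : ℝ) := Finset.sum_le_sum fun l _ => by
          rw [abs_mul, hside, one_mul]
          exact hs _
      _ = _ := by
          simp [levels, Finset.card_disjSum]
          ring
  have horth : ∑ z ∈ cells m, (∑ l ∈ levels m, side l z * g (node l z)) *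
      (∑ l ∈ levels m, side l z * s (node l z)) = ∑ z ∈ cells m, ∑ l ∈ levels m, |g (node l z)| := by
    simp only [Finset.sum_mul_sum]
    rw [Finset.sum_comm]
    conv_rhs => rw [Finset.sum_comm]
    refine Finset.sum_congr rfl fun l hl => ?_
    rw [Finset.sum_comm]
    rw [Finset.sum_eq_single_of_mem l hl
      fun l' hl' hne => sum_side_mul_side_eq_zero hl hl' hne.symm g s]
    refine Finset.sum_congr rfl fun z _ => ?_
    have h1 : (side l z : ℝ) * side l z = 1 := by
      rcases side_eq_or l z with h | h <;> simp [h]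
    calc _ = (side l z * side l z : ℝ) * (s (node l z) * g (node l z)) := by ring
      _ = _ := by rw [h1, one_mul, sign_mul_self]
  rw [← horth, Finset.mul_sum]
  refine Finset.sum_le_sum fun z _ => (le_abs_self _).trans ?_
  rw [abs_mul, mul_comm]
  exact mul_le_mul_of_nonneg_right (hdual z) (abs_nonneg _)

end Haar

/-! ### The exponential potential and its drift. -/

namespace Haar

/-- The base of the exponential potential. -/
noncomputable def base (m : ℕ) : ℝ := (m + 1) / m

/-- The derivative of the potential of a single node. -/
noncomputable def slope (m : ℕ) (x : ℤ) : ℝ := base m ^ x - base m ^ (-x)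

/-- The derivative of the potential in the direction of the Haar functions at `z`. -/
noncomputable def gradient (m : ℕ) (d : ℕ → ℤ) (z : ℕ × ℕ) : ℝ :=
  ∑ l ∈ levels m, side l z * slope m (d (node l z))

/-- The colour that decreases the linear part of the potential. -/
noncomputable def choice (m : ℕ) (d : ℕ → ℤ) (z : ℕ × ℕ) : ℤ :=
  if gradient m d z < 0 then 1 else -1

/-- The Haar coefficients of the colouring after the arrival of `z`. -/
noncomputable def next (m : ℕ) (d : ℕ → ℤ) (z : ℕ × ℕ) : ℕ → ℤ :=
  fun v => d v + choice m d z * haar m z v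

/-- The potential of the Haar coefficients. -/
noncomputable def potential (m : ℕ) (d : ℕ → ℤ) : ℝ :=
  ∑ v ∈ Finset.range (2 ^ (m + 1)), (base m ^ d v + base m ^ (-d v))

theorem choice_eq_or (m : ℕ) (d : ℕ → ℤ) (z : ℕ × ℕ) : choice m d z = 1 ∨ choice m d z = -1 := by
  unfold choice
  split_ifs <;> simp

theorem choice_mul_gradient (m : ℕ) (d : ℕ → ℤ) (z : ℕ × ℕ) :
    choice m d z * gradient m d z = -|gradient m d z| := by
  unfold choice
  split_ifs with h
  · rw [abs_of_neg h]; simp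
  · rw [abs_of_nonneg (not_lt.1 h)]; simp

theorem base_pos {m : ℕ} (hm : 0 < m) : 0 < base m := by unfold base; positivity

theorem one_le_base {m : ℕ} (hm : 0 < m) : 1 ≤ base m := by
  have : (0 : ℝ) < m := by positivity
  rw [base, le_div_iff₀ this]
  linarith

/-- This dictates the value of `base`. With `r = base m`, `(r + r⁻¹) / 2 - 1 = 1 / (2 * m * (m +
1))` and `(r - r⁻¹) / 2` is `2 * m + 1` times as large, which matches the loss in
`sum_abs_le_card_mul_sum_abs`. -/
theorem base_zpow_add_sign {m : ℕ} (hm : 0 < m) (x e : ℤ) (he : e = 1 ∨ e = -1) :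
    base m ^ (x + e) + base m ^ (-(x + e)) = base m ^ x + base m ^ (-x) +
      1 / (2 * m * (m + 1)) * (base m ^ x + base m ^ (-x) + (2 * m + 1) * (e * slope m x)) := by
  have hr := (base_pos hm).ne'
  have h1 : base m ^ (x + 1) = base m ^ x * base m := zpow_add_one₀ hr x
  have h2 : base m ^ (x + -1) = base m ^ x * (base m)⁻¹ := by
    rw [zpow_add₀ hr, zpow_neg_one]
  have h3 : base m ^ (-(x + 1)) = base m ^ (-x) * (base m)⁻¹ := by
    rw [neg_add, zpow_add₀ hr, zpow_neg_one]
  have h4 : base m ^ (-(x + -1)) = base m ^ (-x) * base m := by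
    rw [neg_add, neg_neg, zpow_add_one₀ hr]
  have hm' : (m : ℝ) ≠ 0 := by positivity
  have hm'' : (m : ℝ) + 1 ≠ 0 := by positivity
  rcases he with rfl | rfl
  · rw [h1, h3, slope]
    generalize base m ^ x = a
    generalize base m ^ (-x) = b
    rw [base]
    push_cast
    field_simp
    ring
  · rw [h2, h4, slope]
    generalize base m ^ x = a
    generalize base m ^ (-x) = b
    rw [base]
    push_cast
    field_simp
    ring

/-- Only the nodes above `z`, one per level, change, and `choice` turns the sum of their first-order
terms into `-|gradient|`. -/
theorem potential_next {m : ℕ} (hm : 0 < m) (d : ℕ → ℤ) {z : ℕ × ℕ} (hz : z ∈ cells m) :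
    potential m (next m d z) = potential m d + 1 / (2 * m * (m + 1)) *
      (∑ l ∈ levels m, (base m ^ d (node l z) + base m ^ (-d (node l z))) -
        (2 * m + 1) * |gradient m d z|) := by
  set e := choice m d z with he
  set γ : ℝ := 1 / (2 * m * (m + 1)) with hγ
  set X : ℕ ⊕ ℕ → ℕ → ℝ := fun l v =>
    γ * (base m ^ d v + base m ^ (-d v) + (2 * m + 1) * ((e * side l z : ℤ) * slope m (d v)))
    with hX
  have hnode : ∀ v, base m ^ next m d z v + base m ^ (-next m d z v) =
      base m ^ d v + base m ^ (-d v) + ∑ l ∈ levels m, if node l z = v then X l v else 0 := by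
    intro v
    by_cases h : ∃ l ∈ levels m, node l z = v
    · obtain ⟨l, hl, rfl⟩ := h
      rw [Finset.sum_eq_single_of_mem l hl, if_pos rfl, next, haar_node hl hz hz, if_pos rfl,
        base_zpow_add_sign hm]
      · rcases choice_eq_or m d z with h | h <;> rcases side_eq_or l z with h' | h' <;>
          simp [h, h']
      · intro l' hl' hne
        exact if_neg fun h => hne (level_eq_of_node_eq hl' hl hz hz h)
    · push Not at h
      rw [Finset.sum_eq_zero fun l hl => if_neg (h l hl), next, haar,
        Finset.sum_eq_zero fun l hl => if_neg (h l hl)]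
      simp
  unfold potential
  simp only [hnode, Finset.sum_add_distrib]
  congr 1
  rw [Finset.sum_comm]
  have h1 : ∀ l ∈ levels m, (∑ v ∈ Finset.range (2 ^ (m + 1)), if node l z = v then X l v else 0)
      = X l (node l z) := by
    intro l _
    rw [Finset.sum_ite_eq, if_pos (Finset.mem_range.2 (node_lt hz))]
  rw [Finset.sum_congr rfl h1]
  simp only [hX]
  rw [← Finset.mul_sum]
  congr 1
  rw [Finset.sum_add_distrib, ← Finset.mul_sum, Finset.sum_add_distrib, sub_eq_add_neg,
    ← mul_neg, ← choice_mul_gradient, gradient, Finset.mul_sum (levels m) _ (choice m d z : ℝ)]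
  congr 2
  refine Finset.sum_congr rfl fun l _ => ?_
  push_cast
  ring

/-- The left side is twice the smaller of the two powers, which is at most `1`. -/
theorem base_zpow_sub_abs_slope_le {m : ℕ} (hm : 0 < m) (x : ℤ) :
    base m ^ x + base m ^ (-x) - |slope m x| ≤ 2 := by
  have h1 := one_le_base hm
  rcases le_total 0 x with h | h
  · have h2 : base m ^ (-x) ≤ 1 := zpow_le_one_of_nonpos₀ h1 (by omega)
    have := le_abs_self (slope m x)
    unfold slope at *
    linarith
  · have h2 : base m ^ x ≤ 1 := zpow_le_one_of_nonpos₀ h1 h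
    have := neg_le_abs (slope m x)
    unfold slope at *
    linarith

theorem card_levels (m : ℕ) : (levels m).card = 2 * m + 1 := by
  simp [levels, Finset.card_disjSum]
  ring

/-- The expected increase of the potential is bounded. -/
theorem sum_potential_next_le {m : ℕ} (hm : 0 < m) (d : ℕ → ℤ) :
    ∑ z ∈ cells m, potential m (next m d z) ≤ (cells m).card * (potential m d + 2) := by
  set γ : ℝ := 1 / (2 * m * (m + 1)) with hγ
  have hm1 : (1 : ℝ) ≤ m := by exact_mod_cast hm
  have hγ0 : 0 ≤ γ := by positivity
  have h1 := sum_abs_le_card_mul_sum_abs m (fun v => slope m (d v))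
  have h2 : ∑ z ∈ cells m, ∑ l ∈ levels m, (base m ^ d (node l z) + base m ^ (-d (node l z)) -
      |slope m (d (node l z))|) ≤ (cells m).card * ((2 * m + 1) * 2) := by
    calc _ ≤ ∑ z ∈ cells m, ∑ l ∈ levels m, (2 : ℝ) := Finset.sum_le_sum fun z _ =>
          Finset.sum_le_sum fun l _ => base_zpow_sub_abs_slope_le hm _
      _ = _ := by
        simp only [Finset.sum_const, nsmul_eq_mul, card_levels]
        push_cast
        ring
  have h3 : γ * ((2 * m + 1) * 2) ≤ 2 := by
    rw [hγ, one_div, inv_mul_le_iff₀ (by positivity)]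
    nlinarith
  rw [Finset.sum_congr rfl fun z hz => potential_next hm d hz]
  simp only [Finset.sum_add_distrib, Finset.sum_sub_distrib, ← Finset.mul_sum, Finset.sum_const,
    nsmul_eq_mul] at h2 ⊢
  -- By `h1` the factor `2 * m + 1` in front of `|gradient|` makes up for the duality loss, so the
  -- gradient term outweighs the sum of all `|slope|`.
  have h4 : (∑ z ∈ cells m, ∑ l ∈ levels m, base m ^ d (node l z) +
      ∑ z ∈ cells m, ∑ l ∈ levels m, base m ^ (-d (node l z)) -
      (2 * m + 1) * ∑ z ∈ cells m, |gradient m d z|) ≤ (cells m).card * ((2 * m + 1) * 2) := by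
    refine le_trans ?_ h2
    unfold gradient
    linarith
  have h5 := mul_le_mul_of_nonneg_left h4 hγ0
  have h6 : γ * ((cells m).card * ((2 * m + 1) * 2)) ≤ (cells m).card * 2 := by
    calc _ = (cells m).card * (γ * ((2 * m + 1) * 2)) := by ring
      _ ≤ _ := mul_le_mul_of_nonneg_left h3 (by positivity)
  rw [← hγ]
  linarith

/-- The Haar coefficients after the arrival of a sequence of points. -/
noncomputable def run (m : ℕ) (d : ℕ → ℤ) (l : List (ℕ × ℕ)) : ℕ → ℤ := l.foldl (next m) d

/-- Sums over all cell sequences play the role of expectations. Conditioning on the first cell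
requires the induction hypothesis for an arbitrary initial `d`. -/
theorem sum_potential_run_le {m : ℕ} (hm : 0 < m) (n : ℕ) (d : ℕ → ℤ) :
    ∑ c : Fin n → cells m, potential m (run m d (List.ofFn fun t => (c t : ℕ × ℕ))) ≤
      (cells m).card ^ n * (potential m d + 2 * n) := by
  induction n generalizing d with
  | zero => simp [run]
  | succ n ih =>
    rw [← (Fin.consEquiv fun _ : Fin (n + 1) => cells m).sum_comp, Fintype.sum_prod_type]
    have hstep : ∀ (z : cells m) (c : Fin n → cells m),
        run m d (List.ofFn fun t => ((Fin.consEquiv (fun _ => cells m) (z, c) t : cells m) : ℕ × ℕ))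
          = run m (next m d z) (List.ofFn fun t => (c t : ℕ × ℕ)) := by
      intro z c
      simp [run, List.ofFn_succ, Fin.consEquiv]
    simp only [hstep]
    calc _ ≤ ∑ z : cells m, (cells m).card ^ n * (potential m (next m d z) + 2 * n) :=
          Finset.sum_le_sum fun z _ => ih _
      _ = (cells m).card ^ n * (∑ z ∈ cells m, potential m (next m d z) +
            (cells m).card * (2 * n)) := by
          rw [← Finset.mul_sum, Finset.sum_add_distrib,
            Finset.sum_coe_sort (cells m) (fun z => potential m (next m d z))]
          simp
      _ ≤ (cells m).card ^ n * ((cells m).card * (potential m d + 2) +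
            (cells m).card * (2 * n)) := by
          gcongr
          exact sum_potential_next_le hm d
      _ = _ := by
          push_cast
          ring

/-- Markov's inequality: one coefficient beyond `T` already makes the potential at least `base m ^
T`. -/
theorem card_exists_lt_abs_run_le {m : ℕ} (hm : 0 < m) (n T : ℕ) :
    ((Finset.univ.filter fun c : Fin n → cells m => ∃ v < 2 ^ (m + 1),
        (T : ℤ) < |run m 0 (List.ofFn fun t => (c t : ℕ × ℕ)) v|).card : ℝ) * base m ^ T ≤
      (cells m).card ^ n * (2 * 2 ^ (m + 1) + 2 * n) := by
  have h0 : potential m 0 = 2 * 2 ^ (m + 1) := by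
    simp [potential]
    ring
  have hr := base_pos hm
  have hpos : ∀ d, 0 ≤ potential m d := fun d => Finset.sum_nonneg fun v _ => by positivity
  have h := sum_potential_run_le hm n 0
  rw [h0] at h
  refine le_trans ?_ h
  rw [← nsmul_eq_mul]
  refine (Finset.card_nsmul_le_sum _ _ _ ?_).trans
    (Finset.sum_le_univ_sum_of_nonneg fun c => hpos _)
  intro c hc
  obtain ⟨v, hv, hT⟩ := (Finset.mem_filter.1 hc).2
  set x := run m 0 (List.ofFn fun t => (c t : ℕ × ℕ)) v with hx
  refine le_trans ?_ (Finset.single_le_sum (fun v _ => by positivity) (Finset.mem_range.2 hv))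
  rw [← hx, ← zpow_natCast]
  rcases lt_abs.1 hT with h | h
  · exact (zpow_le_zpow_right₀ (one_le_base hm) h.le).trans (by
      have : 0 < base m ^ (-x) := by positivity
      linarith)
  · exact (zpow_le_zpow_right₀ (one_le_base hm) h.le).trans (by
      have : 0 < base m ^ x := by positivity
      linarith)

end Haar

/-- Chernoff's bound for the number of visits to a subset, by counting. -/
theorem card_le_card_filter_mul_two_pow_le {α : Type*} [Fintype α] (n R : ℕ) (A : α → Prop)
    [DecidablePred A] :
    (Finset.univ.filter fun c : Fin n → α => R ≤ (Finset.univ.filter fun t => A (c t)).card).card *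
      2 ^ R ≤ (Fintype.card α + (Finset.univ.filter A).card) ^ n := by
  -- The exponential moment of the number of visits, with base `2`, factorises over the independent
  -- coordinates.
  have h : ∑ c : Fin n → α, ∏ t, (if A (c t) then 2 else 1) =
      (Fintype.card α + (Finset.univ.filter A).card) ^ n := by
    rw [← Fintype.piFinset_univ, ← Finset.prod_univ_sum (fun _ => Finset.univ)
      (fun _ a => if A a then 2 else 1)]
    have : ∑ a : α, (if A a then 2 else 1) = Fintype.card α + (Finset.univ.filter A).card := by
      rw [Finset.card_filter, ← Finset.card_univ, Finset.card_eq_sum_ones,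
        ← Finset.sum_add_distrib]
      exact Finset.sum_congr rfl fun a _ => by split_ifs <;> rfl
    simp [this]
  rw [← h, ← smul_eq_mul]
  refine (Finset.card_nsmul_le_sum _ _ _ ?_).trans
    (Finset.sum_le_univ_sum_of_nonneg fun c => Nat.zero_le _)
  intro c hc
  rw [Finset.prod_ite, Finset.prod_const, Finset.prod_const_one, mul_one]
  exact Nat.pow_le_pow_right (by norm_num) (Finset.mem_filter.1 hc).2

/-! ### The program -/

namespace StripeAlg

open RamProg

/-- Concatenation of programs. -/
def block : List RamProg → RamProg
  | [] => skip
  | [P] => P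
  | P :: l => seq P (block l)

/-- Find the depth `m` of the trees, the least `m` with `n ≤ 2 ^ m`. Registers: `0` holds `n`,
`2` holds `m`, `3` holds `m + 1`, `4` and `5` hold `1` and `2`, `6` holds `2 * n`. -/
def initDepth : RamProg :=
  block [const 4 1, const 5 2, const 2 0, const 7 1,
    loop 0 (ifLt 7 0 (seq (add 7 7 7) (add 2 2 4)) skip),
    add 3 2 4, add 6 0 0]

/-- Write the powers `(m + 1) ^ j * m ^ (2 * n - j)` into array `2`. -/
def initTable : RamProg :=
  block [const 7 1, loop 6 (mul 7 7 2), const 8 0,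
    loop 6 (block [store 2 8 7, div 7 7 2, mul 7 7 3, add 8 8 4])]

/-- Move register `9` to the parent node and put the digit dropped into register `10`. -/
def ascend : RamProg :=
  block [div 11 9 5, add 12 11 11, sub 10 9 12, copy 9 11]

/-- Add the contribution of a node to the positive part and the negative part of the gradient. -/
def accumulate : RamProg :=
  block [ascend, load 13 0 9, load 14 1 9, add 15 0 13, sub 15 15 14, add 16 0 14, sub 16 16 13,
    load 15 2 15, load 16 2 16,
    ifLt 10 4 (seq (add 17 17 15) (add 18 18 16)) (seq (add 17 17 16) (add 18 18 15))]

/-- Count the new point as a positive or a negative one at a node. -/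
def update : RamProg :=
  block [ascend, load 13 0 9, load 14 1 9,
    ifLt 10 4 (ifLt 1 4 (add 14 14 4) (add 13 13 4)) (ifLt 1 4 (add 13 13 4) (add 14 14 4)),
    store 0 9 13, store 1 9 14]

/-- Find the leaves of the new point. -/
def locate : RamProg :=
  block [const 19 2, loop 2 (block [readX 10, add 19 19 19, add 19 19 10]),
    const 20 3, loop 2 (block [readY 10, add 20 20 20, add 20 20 10])]

/-- Compute the gradient of the potential and choose the colour. -/
def decideColor : RamProg :=
  block [const 17 0, const 18 0, copy 9 19, loop 3 accumulate, copy 9 20, loop 2 accumulate,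
    const 1 0, ifLt 17 18 (const 1 1) skip]

/-- Update the Haar coefficients. -/
def record : RamProg :=
  block [copy 9 19, loop 3 update, copy 9 20, loop 2 update]

/-- The online colouring algorithm. -/
def alg : OnlineAlg where
  init := seq initDepth initTable
  step := block [locate, decideColor, record]

/-! ### Effect of the step program on the memory. -/

section Semantics

variable {σ : RamState}

/-- Registers hold no negative numbers, so a coefficient is the difference of arrays `0` and `1`,
and the gradient that of registers `17` and `18`. Being in a right half swaps the two powers of the
node. -/
theorem exec_accumulate (h4 : σ.reg 4 = 1) (h5 : σ.reg 5 = 2) :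
    (accumulate.exec σ).reg 9 = σ.reg 9 / 2 ∧
    (accumulate.exec σ).reg 17 = σ.reg 17 + (if σ.reg 9 % 2 = 0
      then σ.arr 2 (σ.reg 0 + σ.arr 0 (σ.reg 9 / 2) - σ.arr 1 (σ.reg 9 / 2))
      else σ.arr 2 (σ.reg 0 + σ.arr 1 (σ.reg 9 / 2) - σ.arr 0 (σ.reg 9 / 2))) ∧
    (accumulate.exec σ).reg 18 = σ.reg 18 + (if σ.reg 9 % 2 = 0
      then σ.arr 2 (σ.reg 0 + σ.arr 1 (σ.reg 9 / 2) - σ.arr 0 (σ.reg 9 / 2))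
      else σ.arr 2 (σ.reg 0 + σ.arr 0 (σ.reg 9 / 2) - σ.arr 1 (σ.reg 9 / 2))) := by
  have h2 : σ.reg 9 - (σ.reg 9 / 2 + σ.reg 9 / 2) = σ.reg 9 % 2 := by omega
  rcases Nat.mod_two_eq_zero_or_one (σ.reg 9) with h | h <;>
    simp [accumulate, ascend, block, exec, RamState.setReg, h4, h5, h2, h]

theorem exec_update (h4 : σ.reg 4 = 1) (h5 : σ.reg 5 = 2) (h1 : σ.reg 1 = 0 ∨ σ.reg 1 = 1) :
    (update.exec σ).reg 9 = σ.reg 9 / 2 ∧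
    ∀ v, ((update.exec σ).arr 0 v : ℤ) - (update.exec σ).arr 1 v = (σ.arr 0 v : ℤ) - σ.arr 1 v +
      if σ.reg 9 / 2 = v then (if σ.reg 1 = 0 then -1 else 1) * Haar.bitSign (σ.reg 9) 0 else 0 := by
  have h2 : σ.reg 9 - (σ.reg 9 / 2 + σ.reg 9 / 2) = σ.reg 9 % 2 := by omega
  rcases Nat.mod_two_eq_zero_or_one (σ.reg 9) with h | h <;> rcases h1 with h1 | h1 <;>
    simp [update, ascend, block, exec, RamState.setReg, RamState.setArr, h4, h5, h2, h, h1,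
      Haar.bitSign, Function.update_apply, eq_comm (a := σ.reg 9 / 2)] <;>
    intro v <;> split_ifs <;> simp_all <;> ring

end Semantics

end StripeAlg

namespace StripeAlg

open RamProg Haar

theorem sum_range_succ_bits {M : Type*} [AddCommMonoid M] (F : ℕ → ℕ → M) (w k : ℕ) :
    ∑ i ∈ Finset.range (k + 1), F (w / 2 ^ i % 2) (w / 2 ^ (i + 1)) =
      ∑ i ∈ Finset.range k, F (w / 2 ^ i % 2) (w / 2 ^ (i + 1)) +
        F (w / 2 ^ k % 2) (w / 2 ^ k / 2) := by
  rw [Finset.sum_range_succ, Nat.div_div_eq_div_mul, ← pow_succ]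

theorem iterate_accumulate {σ : RamState} (h4 : σ.reg 4 = 1) (h5 : σ.reg 5 = 2) (k : ℕ) :
    let p := fun v => σ.arr 2 (σ.reg 0 + σ.arr 0 v - σ.arr 1 v)
    let q := fun v => σ.arr 2 (σ.reg 0 + σ.arr 1 v - σ.arr 0 v)
    ((exec accumulate)^[k] σ).reg 9 = σ.reg 9 / 2 ^ k ∧
    ((exec accumulate)^[k] σ).reg 17 = σ.reg 17 + ∑ i ∈ Finset.range k,
      (if σ.reg 9 / 2 ^ i % 2 = 0 then p (σ.reg 9 / 2 ^ (i + 1)) else q (σ.reg 9 / 2 ^ (i + 1))) ∧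
    ((exec accumulate)^[k] σ).reg 18 = σ.reg 18 + ∑ i ∈ Finset.range k,
      (if σ.reg 9 / 2 ^ i % 2 = 0 then q (σ.reg 9 / 2 ^ (i + 1)) else p (σ.reg 9 / 2 ^ (i + 1))) := by
  intro p q
  induction k with
  | zero => simp
  | succ k ih =>
    have hr : ∀ r ∉ accumulate.writes, ((exec accumulate)^[k] σ).reg r = σ.reg r :=
      fun r hr => iterate_exec_reg_of_notMem_writes hr k σ
    have ha : ∀ a ∉ accumulate.stores, ((exec accumulate)^[k] σ).arr a = σ.arr a :=
      fun a ha => iterate_exec_arr_of_notMem_stores ha k σ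
    have h := exec_accumulate ((hr 4 (by decide)).trans h4) ((hr 5 (by decide)).trans h5)
    rw [Function.iterate_succ_apply', h.1, h.2.1, h.2.2, ih.1, ih.2.1, ih.2.2, hr 0 (by decide),
      ha 0 (by decide), ha 1 (by decide), ha 2 (by decide),
      sum_range_succ_bits (fun b v => if b = 0 then p v else q v),
      sum_range_succ_bits (fun b v => if b = 0 then q v else p v)]
    refine ⟨?_, ?_, ?_⟩
    · rw [Nat.div_div_eq_div_mul, pow_succ]
    · rw [add_assoc]
    · rw [add_assoc]

theorem iterate_update {σ : RamState} (h4 : σ.reg 4 = 1) (h5 : σ.reg 5 = 2)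
    (h1 : σ.reg 1 = 0 ∨ σ.reg 1 = 1) (k : ℕ) :
    ((exec update)^[k] σ).reg 9 = σ.reg 9 / 2 ^ k ∧
    ∀ v, (((exec update)^[k] σ).arr 0 v : ℤ) - ((exec update)^[k] σ).arr 1 v =
      (σ.arr 0 v : ℤ) - σ.arr 1 v + (if σ.reg 1 = 0 then -1 else 1) * ∑ i ∈ Finset.range k,
        if σ.reg 9 / 2 ^ (i + 1) = v then bitSign (σ.reg 9) i else 0 := by
  induction k with
  | zero => simp
  | succ k ih =>
    have hr : ∀ r ∉ update.writes, ((exec update)^[k] σ).reg r = σ.reg r :=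
      fun r hr => iterate_exec_reg_of_notMem_writes hr k σ
    have h1' := hr 1 (by decide)
    have h := exec_update ((hr 4 (by decide)).trans h4) ((hr 5 (by decide)).trans h5)
      (by rwa [h1'])
    rw [Function.iterate_succ_apply']
    refine ⟨?_, fun v => ?_⟩
    · rw [h.1, ih.1, Nat.div_div_eq_div_mul, pow_succ]
    · rw [h.2 v, ih.2 v, ih.1, h1', Nat.div_div_eq_div_mul, ← pow_succ, Finset.sum_range_succ]
      have : bitSign (σ.reg 9 / 2 ^ k) 0 = bitSign (σ.reg 9) k := by simp [bitSign]
      rw [this, mul_add, mul_ite, mul_zero, add_assoc]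

/-- The memory after the arrival of `t` points that lead to the Haar coefficients `d`. -/
structure Inv (n m t : ℕ) (d : ℕ → ℤ) (σ : RamState) : Prop where
  reg0 : σ.reg 0 = n
  reg2 : σ.reg 2 = m
  reg3 : σ.reg 3 = m + 1
  reg4 : σ.reg 4 = 1
  reg5 : σ.reg 5 = 2
  table : ∀ j < 2 * n, σ.arr 2 j = (m + 1) ^ j * m ^ (2 * n - j)
  coeff : ∀ v, (σ.arr 0 v : ℤ) - σ.arr 1 v = d v
  bound : ∀ v, |d v| ≤ t

theorem Inv.exec_of_frame {n m t : ℕ} {d : ℕ → ℤ} {σ : RamState} (h : Inv n m t d σ) {P : RamProg}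
    (hw : Disjoint {0, 2, 3, 4, 5} P.writes) (hs : P.stores = ∅) : Inv n m t d (P.exec σ) := by
  have hr : ∀ r ∈ ({0, 2, 3, 4, 5} : Finset ℕ), (P.exec σ).reg r = σ.reg r := fun r hr =>
    exec_reg_of_notMem_writes (Finset.disjoint_left.1 hw hr) σ
  have ha : ∀ a, (P.exec σ).arr a = σ.arr a := fun a =>
    exec_arr_of_notMem_stores (by simp [hs]) σ
  exact ⟨(hr 0 (by simp)).trans h.reg0, (hr 2 (by simp)).trans h.reg2,
    (hr 3 (by simp)).trans h.reg3, (hr 4 (by simp)).trans h.reg4, (hr 5 (by simp)).trans h.reg5,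
    by rw [ha]; exact h.table, by rw [ha, ha]; exact h.coeff, h.bound⟩

/-- One common positive factor clears the denominators of all powers of `base m` that can occur, so
gradients are compared without rounding. -/
theorem table_eq {n m : ℕ} (hm : 0 < m) {j : ℕ} (hj : j < 2 * n) (x : ℤ) (hx : (j : ℤ) = n + x) :
    (((m + 1) ^ j * m ^ (2 * n - j) : ℕ) : ℝ) = ((m + 1) * m : ℝ) ^ n * base m ^ x := by
  have h0 : (m : ℝ) ≠ 0 := by positivity
  have h1 : (m : ℝ) + 1 ≠ 0 := by positivity
  push_cast
  rw [base, div_zpow, mul_pow, ← zpow_natCast, ← zpow_natCast, ← zpow_natCast, ← zpow_natCast]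
  rw [hx, show ((2 * n - j : ℕ) : ℤ) = n - x by omega, zpow_add₀ h1, zpow_sub₀ h0]
  field_simp

/-- Leaves of a point of the unit square. -/
noncomputable def cell (m : ℕ) (z : ℝ × ℝ) : ℕ × ℕ :=
  (2 * 2 ^ m + ⌊z.1 * 2 ^ m⌋₊, 3 * 2 ^ m + ⌊z.2 * 2 ^ m⌋₊)

theorem cell_mem_cells {m : ℕ} {z : ℝ × ℝ} (hx : z.1 ∈ Ico (0 : ℝ) 1) (hy : z.2 ∈ Ico (0 : ℝ) 1) :
    cell m z ∈ cells m := by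
  have key : ∀ x ∈ Ico (0 : ℝ) 1, ⌊x * 2 ^ m⌋₊ < 2 ^ m := by
    intro x hx
    rw [Nat.floor_lt (mul_nonneg hx.1 (by positivity))]
    push_cast
    exact mul_lt_of_lt_one_left (by positivity) hx.2
  have h1 := key _ hx
  have h2 := key _ hy
  simp only [cells, cell, Finset.mem_product, Finset.mem_Ico]
  omega

/-- Halving under the floor drops the last binary digit; hence leaf indices can be built digit by
digit from the tapes. -/
theorem floor_digits (x : ℝ) (j : ℕ) :
    ⌊x * 2 ^ (j + 1)⌋₊ = 2 * ⌊x * 2 ^ j⌋₊ + (Real.digits x 2 j : ℕ) := by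
  have h1 : ⌊x * 2 ^ j⌋₊ = ⌊x * 2 ^ (j + 1)⌋₊ / 2 := by
    rw [← Nat.floor_div_ofNat]
    congr 1
    rw [pow_succ, ← mul_assoc, mul_div_cancel_right₀ _ (by norm_num)]
  have h2 : (Real.digits x 2 j : ℕ) = ⌊x * 2 ^ (j + 1)⌋₊ % 2 := by
    simp [Real.digits, Fin.ofNat]
  omega

theorem exec_readX_loop {σ : RamState} {x : ℝ} (hx : x ∈ Ico (0 : ℝ) 1)
    (hσ : σ.tapeX = Real.digits x 2) (k : ℕ) :
    let τ := (exec (block [readX 10, add 19 19 19, add 19 19 10]))^[k] σ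
    τ.reg 19 = σ.reg 19 * 2 ^ k + ⌊x * 2 ^ k⌋₊ ∧ τ.tapeX = (fun j => Real.digits x 2 (j + k)) ∧
      τ.tapeY = σ.tapeY := by
  induction k with
  | zero => simp [hσ, Nat.floor_eq_zero.2 hx.2]
  | succ k ih =>
    simp only at ih ⊢
    rw [Function.iterate_succ_apply']
    generalize (exec (block [readX 10, add 19 19 19, add 19 19 10]))^[k] σ = τ at ih
    obtain ⟨h1, h2, h3⟩ := ih
    refine ⟨?_, ?_, ?_⟩
    · rw [floor_digits, pow_succ]
      simp [block, exec, RamState.setReg, h1, h2]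
      ring
    · simp [block, exec, RamState.setReg, h2]
      funext j
      rw [add_right_comm, add_assoc]
    · simp [block, exec, RamState.setReg, h3]

theorem exec_readY_loop {σ : RamState} {y : ℝ} (hy : y ∈ Ico (0 : ℝ) 1)
    (hσ : σ.tapeY = Real.digits y 2) (k : ℕ) :
    let τ := (exec (block [readY 10, add 20 20 20, add 20 20 10]))^[k] σ
    τ.reg 20 = σ.reg 20 * 2 ^ k + ⌊y * 2 ^ k⌋₊ ∧ τ.tapeY = (fun j => Real.digits y 2 (j + k)) := by
  induction k with
  | zero => simp [hσ, Nat.floor_eq_zero.2 hy.2]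
  | succ k ih =>
    simp only at ih ⊢
    rw [Function.iterate_succ_apply']
    generalize (exec (block [readY 10, add 20 20 20, add 20 20 10]))^[k] σ = τ at ih
    obtain ⟨h1, h2⟩ := ih
    refine ⟨?_, ?_⟩
    · rw [floor_digits, pow_succ]
      simp [block, exec, RamState.setReg, h1, h2]
      ring
    · simp [block, exec, RamState.setReg, h2]
      funext j
      rw [add_right_comm, add_assoc]

theorem exec_locate {σ : RamState} {z : ℝ × ℝ} (hx : z.1 ∈ Ico (0 : ℝ) 1)
    (hy : z.2 ∈ Ico (0 : ℝ) 1) {m : ℕ} (hm : σ.reg 2 = m) :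
    (locate.exec (OnlineAlg.feed z σ)).reg 19 = (cell m z).1 ∧
    (locate.exec (OnlineAlg.feed z σ)).reg 20 = (cell m z).2 := by
  set σ₀ := exec (const 19 2) (OnlineAlg.feed z σ) with hσ₀
  set σ₁ := exec (loop 2 (block [readX 10, add 19 19 19, add 19 19 10])) σ₀ with hσ₁
  set σ₂ := exec (const 20 3) σ₁ with hσ₂
  set σ₃ := exec (loop 2 (block [readY 10, add 20 20 20, add 20 20 10])) σ₂ with hσ₃
  have e : locate.exec (OnlineAlg.feed z σ) = σ₃ := rfl
  have h0 : σ₀.reg 2 = m := hm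
  have h1 : σ₁.reg 19 = (cell m z).1 ∧ σ₁.tapeY = Real.digits z.2 2 := by
    have := exec_readX_loop (σ := σ₀) hx rfl m
    rw [hσ₁, exec, h0]
    exact ⟨this.1, this.2.2⟩
  have h2 : σ₁.reg 2 = m := (exec_reg_of_notMem_writes (by decide) σ₀).trans h0
  have h3 : σ₂.reg 2 = m := h2
  rw [e]
  constructor
  · rw [hσ₃, exec_reg_of_notMem_writes (by decide) σ₂]
    exact h1.1
  · have := exec_readY_loop (σ := σ₂) hy h1.2 m
    rw [hσ₃, exec, h3]
    exact this.1

theorem exec_decideColor {n m t : ℕ} {d : ℕ → ℤ} {σ : RamState} (h : Inv n m t d σ) (hm : 0 < m)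
    (ht : t < n) :
    (if (decideColor.exec σ).reg 1 = 0 then -1 else 1) = choice m d (σ.reg 19, σ.reg 20) ∧
      ((decideColor.exec σ).reg 1 = 0 ∨ (decideColor.exec σ).reg 1 = 1) := by
  set σ₀ := exec (block [const 17 0, const 18 0, copy 9 19]) σ with hσ₀
  set σ₁ := exec (loop 3 accumulate) σ₀ with hσ₁
  set σ₂ := exec (copy 9 20) σ₁ with hσ₂
  set σ₃ := exec (loop 2 accumulate) σ₂ with hσ₃
  have e : decideColor.exec σ = exec (ifLt 17 18 (const 1 1) skip) (exec (const 1 0) σ₃) := rfl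
  have i0 : Inv n m t d σ₀ := h.exec_of_frame (by decide) (by decide)
  have i1 : Inv n m t d σ₁ := i0.exec_of_frame (by decide) (by decide)
  have i2 : Inv n m t d σ₂ := i1.exec_of_frame (by decide) (by decide)
  have w0 : σ₀.reg 9 = σ.reg 19 := by simp [hσ₀, block, exec, RamState.setReg]
  have w2 : σ₂.reg 9 = σ.reg 20 := by
    have : σ₁.reg 20 = σ₀.reg 20 := exec_reg_of_notMem_writes (by decide) σ₀
    simp only [hσ₂, exec, RamState.setReg, Function.update_self, this]
    rfl
  set V : ℕ → ℕ := fun v => (m + 1) ^ (n + d v).toNat * m ^ (2 * n - (n + d v).toNat) with hV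
  set V' : ℕ → ℕ := fun v => (m + 1) ^ (n - d v).toNat * m ^ (2 * n - (n - d v).toNat) with hV'
  -- Since `|d v| ≤ t < n`, the truncated subtraction loses nothing and the index `n ± d v` stays
  -- below `2 * n`, inside the table.
  have lookup : ∀ τ, Inv n m t d τ → (∀ v, τ.arr 2 (τ.reg 0 + τ.arr 0 v - τ.arr 1 v) = V v) ∧
      ∀ v, τ.arr 2 (τ.reg 0 + τ.arr 1 v - τ.arr 0 v) = V' v := by
    intro τ hτ
    refine ⟨fun v => ?_, fun v => ?_⟩
    · have h1 := hτ.coeff v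
      have h2 := abs_le.1 (hτ.bound v)
      rw [hτ.reg0, show n + τ.arr 0 v - τ.arr 1 v = (n + d v).toNat by omega]
      exact hτ.table _ (by omega)
    · have h1 := hτ.coeff v
      have h2 := abs_le.1 (hτ.bound v)
      rw [hτ.reg0, show n + τ.arr 1 v - τ.arr 0 v = (n - d v).toNat by omega]
      exact hτ.table _ (by omega)
  -- The climb in the first tree has one more step, so that the common root is counted exactly once.
  have a0 := iterate_accumulate i0.reg4 i0.reg5 (m + 1)
  have a2 := iterate_accumulate i2.reg4 i2.reg5 m
  simp only [(lookup σ₀ i0).1, (lookup σ₀ i0).2, w0] at a0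
  simp only [(lookup σ₂ i2).1, (lookup σ₂ i2).2, w2] at a2
  have e1 : σ₁ = (exec accumulate)^[m + 1] σ₀ := by rw [hσ₁, exec, i0.reg3]
  have e3 : σ₃ = (exec accumulate)^[m] σ₂ := by rw [hσ₃, exec, i2.reg2]
  rw [← e1] at a0
  rw [← e3] at a2
  have z17 : σ₀.reg 17 = 0 := by simp [hσ₀, block, exec, RamState.setReg]
  have z18 : σ₀.reg 18 = 0 := by simp [hσ₀, block, exec, RamState.setReg]
  have c17 : σ₂.reg 17 = σ₁.reg 17 := exec_reg_of_notMem_writes (by decide) σ₁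
  have c18 : σ₂.reg 18 = σ₁.reg 18 := exec_reg_of_notMem_writes (by decide) σ₁
  have h17 := a2.2.1
  have h18 := a2.2.2
  rw [c17, a0.2.1, z17, zero_add] at h17
  rw [c18, a0.2.2, z18, zero_add] at h18
  have hslope : ∀ v, (V v : ℝ) - V' v = ((m + 1) * m : ℝ) ^ n * slope m (d v) := by
    intro v
    have h2 := abs_le.1 (h.bound v)
    simp only [hV, hV', Haar.slope]
    rw [table_eq hm (by omega) (d v) (by omega), table_eq hm (by omega) (-d v) (by omega)]
    ring
  have hdiff : (σ₃.reg 17 : ℝ) - σ₃.reg 18 =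
      ((m + 1) * m : ℝ) ^ n * gradient m d (σ.reg 19, σ.reg 20) := by
    have hsum : ∀ w k : ℕ, ((∑ i ∈ Finset.range k, if w / 2 ^ i % 2 = 0
        then V (w / 2 ^ (i + 1)) else V' (w / 2 ^ (i + 1)) : ℕ) : ℝ) -
        (∑ i ∈ Finset.range k, if w / 2 ^ i % 2 = 0
        then V' (w / 2 ^ (i + 1)) else V (w / 2 ^ (i + 1)) : ℕ) =
        ((m + 1) * m : ℝ) ^ n *
          ∑ i ∈ Finset.range k, bitSign w i * slope m (d (w / 2 ^ (i + 1))) := by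
      intro w k
      push_cast
      rw [← Finset.sum_sub_distrib, Finset.mul_sum]
      refine Finset.sum_congr rfl fun i _ => ?_
      rw [mul_left_comm, ← hslope, bitSign]
      split_ifs
      · simp
      · simp
    rw [h17, h18, Haar.gradient, levels, Finset.sum_disjSum]
    simp only [side, node]
    rw [mul_add, ← hsum, ← hsum]
    push_cast
    ring
  have hlt : σ₃.reg 17 < σ₃.reg 18 ↔ gradient m d (σ.reg 19, σ.reg 20) < 0 := by
    have hpos : (0 : ℝ) < ((m + 1) * m : ℝ) ^ n := by positivity
    rw [← Nat.cast_lt (α := ℝ), ← sub_neg, hdiff, mul_neg_iff]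
    constructor
    · rintro (h | h)
      · exact h.2
      · linarith [h.1]
    · exact fun h => .inl ⟨hpos, h⟩
  rw [e, choice]
  by_cases hc : σ₃.reg 17 < σ₃.reg 18 <;> simp [exec, RamState.setReg, ← hlt, hc]

theorem Inv.step {n m t : ℕ} {d : ℕ → ℤ} {σ : RamState} (h : Inv n m t d σ) (hm : 0 < m)
    (ht : t < n) {z : ℝ × ℝ} (hx : z.1 ∈ Ico (0 : ℝ) 1) (hy : z.2 ∈ Ico (0 : ℝ) 1) :
    Inv n m (t + 1) (next m d (cell m z)) (alg.step.exec (OnlineAlg.feed z σ)) ∧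
      (if (alg.step.exec (OnlineAlg.feed z σ)).reg 1 = 0 then -1 else 1) =
        choice m d (cell m z) := by
  set σ₀ := locate.exec (OnlineAlg.feed z σ) with hσ₀
  set σ₁ := decideColor.exec σ₀ with hσ₁
  set σ₂ := exec (copy 9 19) σ₁ with hσ₂
  set σ₃ := exec (loop 3 update) σ₂ with hσ₃
  set σ₄ := exec (copy 9 20) σ₃ with hσ₄
  set σ₅ := exec (loop 2 update) σ₄ with hσ₅
  have e : alg.step.exec (OnlineAlg.feed z σ) = σ₅ := rfl
  have hf : Inv n m t d (OnlineAlg.feed z σ) :=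
    ⟨h.reg0, h.reg2, h.reg3, h.reg4, h.reg5, h.table, h.coeff, h.bound⟩
  have i0 : Inv n m t d σ₀ := hf.exec_of_frame (by decide) (by decide)
  have i1 : Inv n m t d σ₁ := i0.exec_of_frame (by decide) (by decide)
  have i2 : Inv n m t d σ₂ := i1.exec_of_frame (by decide) (by decide)
  obtain ⟨l19, l20⟩ := exec_locate hx hy h.reg2
  obtain ⟨hc, hc'⟩ := exec_decideColor i0 hm ht
  rw [← hσ₀] at l19 l20
  rw [l19, l20, ← hσ₁] at hc
  rw [← hσ₁] at hc'
  have r3 : ∀ r ∉ (loop 3 update).writes, σ₃.reg r = σ₂.reg r := fun r hr =>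
    exec_reg_of_notMem_writes hr σ₂
  have r5 : ∀ r ∉ (loop 2 update).writes, σ₅.reg r = σ₄.reg r := fun r hr =>
    exec_reg_of_notMem_writes hr σ₄
  have r1 : ∀ r ∉ decideColor.writes, σ₁.reg r = σ₀.reg r := fun r hr =>
    exec_reg_of_notMem_writes hr σ₀
  have q2 : ∀ r, r ≠ 9 → σ₂.reg r = σ₁.reg r := fun r hr =>
    exec_reg_of_notMem_writes (by simpa [writes] using hr) σ₁
  have q4 : ∀ r, r ≠ 9 → σ₄.reg r = σ₃.reg r := fun r hr =>
    exec_reg_of_notMem_writes (by simpa [writes] using hr) σ₃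
  have w2 : σ₂.reg 9 = (cell m z).1 := by
    simp only [hσ₂, exec, RamState.setReg, Function.update_self, r1 19 (by decide), l19]
  have w4 : σ₄.reg 9 = (cell m z).2 := by
    have : σ₃.reg 20 = (cell m z).2 := by
      rw [r3 20 (by decide), q2 20 (by decide), r1 20 (by decide), l20]
    simp only [hσ₄, exec, RamState.setReg, Function.update_self, this]
  have c2 : σ₂.reg 1 = σ₁.reg 1 := q2 1 (by decide)
  have c4 : σ₄.reg 1 = σ₁.reg 1 := by rw [q4 1 (by decide), r3 1 (by decide), c2]
  have c5 : σ₅.reg 1 = σ₁.reg 1 := by rw [r5 1 (by decide), c4]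
  have u2 := iterate_update i2.reg4 i2.reg5 (by rwa [c2]) (m + 1)
  have g4 : ∀ r ∈ ({0, 2, 3, 4, 5} : Finset ℕ), σ₄.reg r = σ₂.reg r := by
    intro r hr
    rw [q4 r (by rintro rfl; revert hr; decide),
      r3 r (Finset.disjoint_left.1 (by decide : Disjoint {0, 2, 3, 4, 5} (loop 3 update).writes) hr)]
  have g5 : ∀ r ∈ ({0, 2, 3, 4, 5} : Finset ℕ), σ₅.reg r = σ₂.reg r := by
    intro r hr
    rw [r5 r (Finset.disjoint_left.1
      (by decide : Disjoint {0, 2, 3, 4, 5} (loop 2 update).writes) hr), g4 r hr]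
  have u4 := iterate_update ((g4 4 (by decide)).trans i2.reg4) ((g4 5 (by decide)).trans i2.reg5)
    (by rwa [c4]) m
  have e3 : σ₃ = (exec update)^[m + 1] σ₂ := by rw [hσ₃, exec, i2.reg3]
  have e5 : σ₅ = (exec update)^[m] σ₄ := by rw [hσ₅, exec, g4 2 (by decide), i2.reg2]
  rw [← e3, w2, c2, hc] at u2
  rw [← e5, w4, c4, hc] at u4
  have a4 : σ₄.arr = σ₃.arr := rfl
  have a5 : σ₅.arr 2 = σ₂.arr 2 := by
    rw [hσ₅, exec_arr_of_notMem_stores (by decide) σ₄, a4, hσ₃,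
      exec_arr_of_notMem_stores (by decide) σ₂]
  rw [e, c5]
  refine ⟨⟨(g5 0 (by decide)).trans i2.reg0, (g5 2 (by decide)).trans i2.reg2,
    (g5 3 (by decide)).trans i2.reg3, (g5 4 (by decide)).trans i2.reg4,
    (g5 5 (by decide)).trans i2.reg5, by rw [a5]; exact i2.table, fun v => ?_, fun v => ?_⟩, hc⟩
  · rw [u4.2 v, a4, u2.2 v, i2.coeff, next, haar, levels, Finset.sum_disjSum]
    simp only [side, node]
    ring_nf
  · have h1 := h.bound v
    have h2 := abs_haar_le_one (cell_mem_cells (m := m) hx hy) v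
    have h3 : |choice m d (cell m z) * haar m (cell m z) v| ≤ 1 := by
      rcases choice_eq_or m d (cell m z) with h | h <;> simpa [h] using h2
    rw [next]
    push_cast
    exact (abs_add_le _ _).trans (add_le_add h1 h3)

end StripeAlg

/-! ### Correctness of the initialization. -/

namespace StripeAlg

open RamProg Haar

/-- The test against `n` freezes both registers once the power of two reaches `n`; as `Nat.clog 2 n
≤ n`, a loop of `n` rounds is long enough. -/
theorem iterate_depth {n : ℕ} {σ : RamState} (h0 : σ.reg 0 = n) (h2 : σ.reg 2 = 0)
    (h4 : σ.reg 4 = 1) (h7 : σ.reg 7 = 1) (k : ℕ) :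
    let τ := (exec (ifLt 7 0 (seq (add 7 7 7) (add 2 2 4)) skip))^[k] σ
    τ.reg 7 = 2 ^ min k (Nat.clog 2 n) ∧ τ.reg 2 = min k (Nat.clog 2 n) := by
  intro τ
  induction k with
  | zero => simp [τ, h2, h7]
  | succ k ih =>
    have hr0 : ((exec (ifLt 7 0 (seq (add 7 7 7) (add 2 2 4)) skip))^[k] σ).reg 0 = n :=
      (iterate_exec_reg_of_notMem_writes (by decide) k σ).trans h0
    have hr4 : ((exec (ifLt 7 0 (seq (add 7 7 7) (add 2 2 4)) skip))^[k] σ).reg 4 = 1 :=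
      (iterate_exec_reg_of_notMem_writes (by decide) k σ).trans h4
    simp only [τ] at ih ⊢
    rw [Function.iterate_succ_apply']
    generalize (exec (ifLt 7 0 (seq (add 7 7 7) (add 2 2 4)) skip))^[k] σ = ρ at *
    by_cases hk : k < Nat.clog 2 n
    · have h1 : min k (Nat.clog 2 n) = k := by omega
      have h2 : min (k + 1) (Nat.clog 2 n) = k + 1 := by omega
      have h3 : 2 ^ k < n := (Nat.lt_clog_iff_pow_lt (by norm_num)).1 hk
      rw [h1] at ih
      simp [exec, RamState.setReg, ih.1, ih.2, hr0, hr4, h3, h2, pow_succ]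
      ring
    · have h1 : min k (Nat.clog 2 n) = Nat.clog 2 n := by omega
      have h2 : min (k + 1) (Nat.clog 2 n) = Nat.clog 2 n := by omega
      have h3 : ¬ 2 ^ Nat.clog 2 n < n := not_lt.2 (Nat.le_pow_clog (by norm_num) n)
      rw [h1] at ih
      simp [exec, ih.1, ih.2, hr0, h3, h2]

theorem clog_two_le_self (n : ℕ) : Nat.clog 2 n ≤ n :=
  Nat.clog_le_of_le_pow Nat.lt_two_pow_self.le

theorem exec_initDepth (n : ℕ) :
    let τ := initDepth.exec (OnlineAlg.start n)
    τ.reg 0 = n ∧ τ.reg 2 = Nat.clog 2 n ∧ τ.reg 3 = Nat.clog 2 n + 1 ∧ τ.reg 4 = 1 ∧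
      τ.reg 5 = 2 ∧ τ.reg 6 = 2 * n := by
  set σ₀ := exec (block [const 4 1, const 5 2, const 2 0, const 7 1]) (OnlineAlg.start n) with hσ₀
  set σ₁ := exec (loop 0 (ifLt 7 0 (seq (add 7 7 7) (add 2 2 4)) skip)) σ₀ with hσ₁
  have e : initDepth.exec (OnlineAlg.start n) = exec (block [add 3 2 4, add 6 0 0]) σ₁ := rfl
  have h0 : σ₀.reg 0 = n := rfl
  have h4 : σ₀.reg 4 = 1 := rfl
  have h5 : σ₀.reg 5 = 2 := rfl
  have hd := iterate_depth h0 rfl h4 rfl n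
  have e1 : σ₁ = (exec (ifLt 7 0 (seq (add 7 7 7) (add 2 2 4)) skip))^[n] σ₀ := by
    rw [hσ₁, exec, h0]
  simp only at hd
  rw [← e1, min_eq_right (clog_two_le_self n)] at hd
  have r0 : σ₁.reg 0 = n := (exec_reg_of_notMem_writes (by decide) σ₀).trans h0
  have r4 : σ₁.reg 4 = 1 := (exec_reg_of_notMem_writes (by decide) σ₀).trans h4
  have r5 : σ₁.reg 5 = 2 := (exec_reg_of_notMem_writes (by decide) σ₀).trans h5
  simp only [e]
  simp [block, exec, RamState.setReg, hd.2, r0, r4, r5]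
  ring

theorem iterate_mul {m : ℕ} {σ : RamState} (h2 : σ.reg 2 = m) (h7 : σ.reg 7 = 1) (k : ℕ) :
    ((exec (mul 7 7 2))^[k] σ).reg 7 = m ^ k := by
  induction k with
  | zero => simp [h7]
  | succ k ih =>
    have hr : ((exec (mul 7 7 2))^[k] σ).reg 2 = m :=
      (iterate_exec_reg_of_notMem_writes (by decide) k σ).trans h2
    rw [Function.iterate_succ_apply']
    generalize (exec (mul 7 7 2))^[k] σ = ρ at *
    simp [exec, RamState.setReg, ih, hr, pow_succ]

theorem iterate_table {m N : ℕ} (hm : 0 < m) {σ : RamState} (h2 : σ.reg 2 = m)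
    (h3 : σ.reg 3 = m + 1) (h4 : σ.reg 4 = 1) (h7 : σ.reg 7 = m ^ N) (h8 : σ.reg 8 = 0) (k : ℕ)
    (hk : k ≤ N) :
    let τ := (exec (block [store 2 8 7, div 7 7 2, mul 7 7 3, add 8 8 4]))^[k] σ
    τ.reg 7 = (m + 1) ^ k * m ^ (N - k) ∧ τ.reg 8 = k ∧
      ∀ j < k, τ.arr 2 j = (m + 1) ^ j * m ^ (N - j) := by
  induction k with
  | zero => simp [h7, h8]
  | succ k ih =>
    set B := block [store 2 8 7, div 7 7 2, mul 7 7 3, add 8 8 4] with hB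
    have hr2 : ((exec B)^[k] σ).reg 2 = m :=
      (iterate_exec_reg_of_notMem_writes (by decide) k σ).trans h2
    have hr3 : ((exec B)^[k] σ).reg 3 = m + 1 :=
      (iterate_exec_reg_of_notMem_writes (by decide) k σ).trans h3
    have hr4 : ((exec B)^[k] σ).reg 4 = 1 :=
      (iterate_exec_reg_of_notMem_writes (by decide) k σ).trans h4
    have ih := ih (by omega)
    simp only at ih ⊢
    rw [Function.iterate_succ_apply']
    generalize (exec B)^[k] σ = ρ at *
    obtain ⟨i7, i8, ia⟩ := ih
    -- The division is exact because `k < N` leaves a factor `m`.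
    have hdiv : (m + 1) ^ k * m ^ (N - k) / m = (m + 1) ^ k * m ^ (N - (k + 1)) := by
      rw [show N - k = N - (k + 1) + 1 by omega, pow_succ, ← mul_assoc, Nat.mul_div_cancel _ hm]
    refine ⟨?_, ?_, fun j hj => ?_⟩
    · simp [hB, block, exec, RamState.setReg, RamState.setArr, i7, hr2, hr3, hdiv]
      ring
    · simp [hB, block, exec, RamState.setReg, RamState.setArr, i8, hr4]
    · have : (exec B ρ).arr 2 j = if j = k then ρ.reg 7 else ρ.arr 2 j := by
        simp [hB, block, exec, RamState.setReg, RamState.setArr, i8, Function.update_apply]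
      rw [this]
      split_ifs with h
      · rw [i7, h]
      · exact ia j (by omega)

theorem inv_init {n : ℕ} (hn : 2 ≤ n) :
    Inv n (Nat.clog 2 n) 0 0 (alg.init.exec (OnlineAlg.start n)) := by
  set m := Nat.clog 2 n with hm
  have hm0 : 0 < m := Nat.clog_pos (by norm_num) hn
  set σ := initDepth.exec (OnlineAlg.start n) with hσ
  obtain ⟨h0, h2, h3, h4, h5, h6⟩ := exec_initDepth n
  rw [← hσ] at h0 h2 h3 h4 h5 h6
  have e : alg.init.exec (OnlineAlg.start n) = initTable.exec σ := rfl
  have hr : ∀ r ∉ initTable.writes, (initTable.exec σ).reg r = σ.reg r := fun r hr =>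
    exec_reg_of_notMem_writes hr σ
  have ha : ∀ a ≠ 2, (initTable.exec σ).arr a = fun _ => 0 := by
    intro a ha
    rw [exec_arr_of_notMem_stores (by simpa [initTable, block, stores] using ha), hσ,
      exec_arr_of_notMem_stores (by simp [initDepth, block, stores])]
    rfl
  rw [e]
  refine ⟨(hr 0 (by decide)).trans h0, (hr 2 (by decide)).trans h2, (hr 3 (by decide)).trans h3,
    (hr 4 (by decide)).trans h4, (hr 5 (by decide)).trans h5, fun j hj => ?_, fun v => ?_,
    fun v => by simp⟩
  · set σ₀ := exec (const 7 1) σ with hσ₀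
    set σ₁ := exec (loop 6 (mul 7 7 2)) σ₀ with hσ₁
    set σ₂ := exec (const 8 0) σ₁ with hσ₂
    have e2 : initTable.exec σ =
        exec (loop 6 (block [store 2 8 7, div 7 7 2, mul 7 7 3, add 8 8 4])) σ₂ := rfl
    have q : ∀ r, r ≠ 7 → r ≠ 8 → σ₂.reg r = σ.reg r := by
      intro r h7 h8
      rw [hσ₂, exec_reg_of_notMem_writes (by simpa [writes] using h8), hσ₁,
        exec_reg_of_notMem_writes (by simpa [writes] using h7), hσ₀,
        exec_reg_of_notMem_writes (by simpa [writes] using h7)]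
    have q7 : σ₂.reg 7 = m ^ (2 * n) := by
      rw [hσ₂, exec_reg_of_notMem_writes (by decide), hσ₁, exec,
        iterate_mul (σ := σ₀) (m := m) h2 rfl, show σ₀.reg 6 = σ.reg 6 from rfl, h6]
    have := iterate_table hm0 ((q 2 (by decide) (by decide)).trans h2)
      ((q 3 (by decide) (by decide)).trans h3) ((q 4 (by decide) (by decide)).trans h4) q7 rfl
      (2 * n) le_rfl
    rw [e2, exec, q 6 (by decide) (by decide), h6]
    exact this.2.2 j hj
  · rw [ha 0 (by decide), ha 1 (by decide)]
    simp

/-! ### Running time -/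

theorem guarded_initDepth : initDepth.GuardedBy {0} := by
  simp [initDepth, block, GuardedBy]

theorem guarded_initTable : initTable.GuardedBy {2, 3, 6} := by
  simp [initTable, block, GuardedBy]

theorem guarded_step : alg.step.GuardedBy {2, 3} := by
  simp [alg, locate, decideColor, record, accumulate, update, ascend, block, GuardedBy]

/-- A bound for the guarding registers. -/
noncomputable def guardBound : Polynomial ℕ := 2 * Polynomial.X + 1

/-- A bound for the binary lengths after the initialization. -/
noncomputable def initSize : Polynomial ℕ :=
  Polynomial.X + 1 + initDepth.cost.comp guardBound + initTable.cost.comp guardBound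

/-- A bound for the time of the initialization. -/
noncomputable def initTime : Polynomial ℕ :=
  initDepth.cost.comp guardBound *
    (1 + 2 * (Polynomial.X + 1 + initDepth.cost.comp guardBound)) +
  initTable.cost.comp guardBound * (1 + 2 * initSize)

/-- The growth of the binary lengths during a step. -/
noncomputable def stepCost : Polynomial ℕ := alg.step.cost.comp guardBound

theorem init_bounds (n : ℕ) :
    (alg.init.exec (OnlineAlg.start n)).SizeLE (initSize.eval n) ∧
      (∀ r ∈ ({2, 3} : Finset ℕ), (alg.init.exec (OnlineAlg.start n)).reg r ≤ guardBound.eval n) ∧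
      alg.init.time (OnlineAlg.start n) ≤ initTime.eval n := by
  -- This dominates every guarding register: `n`, `Nat.clog 2 n`, `Nat.clog 2 n + 1` and `2 * n`.
  have hg : guardBound.eval n = 2 * n + 1 := by simp [guardBound]
  have hs : (OnlineAlg.start n).SizeLE (n + 1) := by
    refine ⟨fun r => ?_, fun a i => by simp [OnlineAlg.start]⟩
    simp only [OnlineAlg.start]
    split_ifs
    · exact (Nat.size_le_self n).trans (Nat.le_succ n)
    · simp
  obtain ⟨h1, h2⟩ := sizeLE_exec_and_time_le (b := guardBound.eval n) guarded_initDepth (by decide)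
    (Nat.le_add_left 1 n) hs (by simp [hg, OnlineAlg.start]; omega)
  obtain ⟨r0, r2, r3, r4, r5, r6⟩ := exec_initDepth n
  have hc := clog_two_le_self n
  obtain ⟨h3, h4⟩ := sizeLE_exec_and_time_le (b := guardBound.eval n) guarded_initTable (by decide)
    (by omega) h1 (by simp [hg, r2, r3, r6]; omega)
  refine ⟨?_, ?_, ?_⟩
  · change (initTable.exec (initDepth.exec (OnlineAlg.start n))).SizeLE _
    simpa [initSize, Polynomial.eval_comp] using h3
  · have hr : ∀ r ∉ initTable.writes, (alg.init.exec (OnlineAlg.start n)).reg r =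
        (initDepth.exec (OnlineAlg.start n)).reg r := fun r hr => exec_reg_of_notMem_writes hr _
    simp only [Finset.mem_insert, Finset.mem_singleton, forall_eq_or_imp, forall_eq]
    rw [hr 2 (by decide), hr 3 (by decide), r2, r3, hg]
    omega
  · have : alg.init.time (OnlineAlg.start n) = initDepth.time (OnlineAlg.start n) +
      initTable.time (initDepth.exec (OnlineAlg.start n)) := rfl
    rw [this]
    simpa [initTime, initSize, Polynomial.eval_comp] using add_le_add h2 h4

/-- Steps never write the guarding registers, so each adds the same amount to the binary lengths,
wherever the points lie. -/
theorem stateAfter_bounds (n : ℕ) (l : List (ℝ × ℝ)) :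
    (alg.stateAfter n l).SizeLE (initSize.eval n + l.length * stepCost.eval n) ∧
      ∀ r ∈ ({2, 3} : Finset ℕ), (alg.stateAfter n l).reg r ≤ guardBound.eval n := by
  induction l using List.reverseRecOn with
  | nil => simpa [OnlineAlg.stateAfter] using ⟨(init_bounds n).1, by simpa using (init_bounds n).2.1⟩
  | append_singleton l z ih =>
    have e : alg.stateAfter n (l ++ [z]) =
        alg.step.exec (OnlineAlg.feed z (alg.stateAfter n l)) := by simp [OnlineAlg.stateAfter]
    have hs : 1 ≤ initSize.eval n + l.length * stepCost.eval n := by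
      simp [initSize]
      omega
    have h := sizeLE_exec_and_time_le (σ := OnlineAlg.feed z (alg.stateAfter n l))
      (b := guardBound.eval n) guarded_step (by decide) hs ih.1 ih.2
    rw [e]
    refine ⟨h.1.mono ?_, fun r hr => ?_⟩
    · simp [stepCost, Polynomial.eval_comp]
      ring_nf
      rfl
    · rw [exec_reg_of_notMem_writes
        (Finset.disjoint_left.1 (by decide : Disjoint {2, 3} alg.step.writes) hr)]
      exact ih.2 r hr

theorem alg_isPolyTime : alg.IsPolyTime := by
  refine ⟨initTime + Polynomial.X * (stepCost * (1 + 2 * (initSize + Polynomial.X * stepCost +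
    stepCost))), fun n p => ?_⟩
  rw [OnlineAlg.runTime, Polynomial.eval_add]
  refine add_le_add (init_bounds n).2.2 ?_
  have h : ∀ t ∈ (Finset.univ : Finset (Fin n)),
      alg.step.time (OnlineAlg.feed (p t) (alg.stateAfter n ((List.ofFn p).take t))) ≤
        (stepCost * (1 + 2 * (initSize + Polynomial.X * stepCost + stepCost))).eval n := by
    intro t _
    have hlen : ((List.ofFn p).take t).length ≤ n := by simp
    obtain ⟨h1, h2⟩ := stateAfter_bounds n ((List.ofFn p).take t)
    have h3 : (alg.stateAfter n ((List.ofFn p).take t)).SizeLE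
        (initSize.eval n + n * stepCost.eval n) := h1.mono (by gcongr)
    have h := (sizeLE_exec_and_time_le
      (σ := OnlineAlg.feed (p t) (alg.stateAfter n ((List.ofFn p).take t)))
      (b := guardBound.eval n) guarded_step (by decide) (by simp [initSize]; omega) h3 h2).2
    simpa [stepCost, Polynomial.eval_comp] using h
  refine (Finset.sum_le_card_nsmul _ _ _ h).trans ?_
  simp

/-! ### The run of the algorithm in terms of Haar coefficients -/

theorem foldl_take_succ {α β : Type*} (f : β → α → β) (b : β) {n : ℕ} (p : Fin n → α) (t : Fin n) :
    ((List.ofFn p).take (t + 1)).foldl f b = f (((List.ofFn p).take t).foldl f b) (p t) := by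
  rw [List.take_succ_eq_append_getElem (by simp), List.foldl_append]
  simp

theorem inv_stateAfter {n : ℕ} (hn : 2 ≤ n) {p : Fin n → ℝ × ℝ}
    (hp : ∀ t, (p t).1 ∈ Ico (0 : ℝ) 1 ∧ (p t).2 ∈ Ico (0 : ℝ) 1) (t : ℕ) (ht : t ≤ n) :
    Inv n (Nat.clog 2 n) t
      (run (Nat.clog 2 n) 0 ((List.ofFn fun t => cell (Nat.clog 2 n) (p t)).take t))
      (alg.stateAfter n ((List.ofFn p).take t)) := by
  induction t with
  | zero => simpa [run, OnlineAlg.stateAfter] using inv_init hn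
  | succ t ih =>
    have h := (ih (by omega)).step (Nat.clog_pos (by norm_num) hn) ht (hp ⟨t, ht⟩).1 (hp ⟨t, ht⟩).2
    have e1 := foldl_take_succ (fun σ z => alg.step.exec (OnlineAlg.feed z σ))
      (alg.init.exec (OnlineAlg.start n)) p ⟨t, ht⟩
    have e2 := foldl_take_succ (next (Nat.clog 2 n)) 0
      (fun t => cell (Nat.clog 2 n) (p t)) ⟨t, ht⟩
    simp only [OnlineAlg.stateAfter, run] at h e1 e2 ⊢
    rw [e1, e2]
    exact h.1

theorem color_eq {n : ℕ} (hn : 2 ≤ n) {p : Fin n → ℝ × ℝ}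
    (hp : ∀ t, (p t).1 ∈ Ico (0 : ℝ) 1 ∧ (p t).2 ∈ Ico (0 : ℝ) 1) (t : Fin n) :
    alg.color p t = choice (Nat.clog 2 n)
      (run (Nat.clog 2 n) 0 ((List.ofFn fun t => cell (Nat.clog 2 n) (p t)).take t))
      (cell (Nat.clog 2 n) (p t)) := by
  have h := ((inv_stateAfter hn hp t t.2.le).step (Nat.clog_pos (by norm_num) hn) t.2
    (hp t).1 (hp t).2).2
  have e1 := foldl_take_succ (fun σ z => alg.step.exec (OnlineAlg.feed z σ))
    (alg.init.exec (OnlineAlg.start n)) p t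
  have e2 : alg.stateAfter n ((List.ofFn p).take (t + 1)) =
      alg.step.exec (OnlineAlg.feed (p t) (alg.stateAfter n ((List.ofFn p).take t))) := e1
  rw [OnlineAlg.color, e2, ← h]

/-- The Haar coefficients of the final colouring. -/
theorem run_eq_sum {n : ℕ} (hn : 2 ≤ n) {p : Fin n → ℝ × ℝ}
    (hp : ∀ t, (p t).1 ∈ Ico (0 : ℝ) 1 ∧ (p t).2 ∈ Ico (0 : ℝ) 1) (v : ℕ) :
    run (Nat.clog 2 n) 0 (List.ofFn fun t => cell (Nat.clog 2 n) (p t)) v =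
      ∑ t, alg.color p t * haar (Nat.clog 2 n) (cell (Nat.clog 2 n) (p t)) v := by
  set m := Nat.clog 2 n
  have key : ∀ k ≤ n, run m 0 ((List.ofFn fun t => cell m (p t)).take k) v =
      ∑ i ∈ Finset.range k, if h : i < n then
        alg.color p ⟨i, h⟩ * haar m (cell m (p ⟨i, h⟩)) v else 0 := by
    intro k
    induction k with
    | zero => simp [run]
    | succ k ih =>
      intro hk
      have e := foldl_take_succ (next m) 0 (fun t => cell m (p t)) ⟨k, hk⟩
      rw [Finset.sum_range_succ, ← ih (by omega), dif_pos (by omega : k < n), color_eq hn hp]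
      simp only [run] at e ⊢
      rw [e]
      rfl
  rw [Finset.sum_fin_eq_sum_range, ← key n le_rfl, List.take_of_length_le (by simp)]

end StripeAlg

/-! ### From Haar coefficients to stripes -/

namespace Haar

section Prefix

variable {n m top : ℕ} {χ : Fin n → ℤ} {W : Fin n → ℕ} {T : ℤ}

/-- The imbalance of a child is the average of the imbalance of its parent and plus or minus the
Haar coefficient there, so the bound `T` passes down the tree without loss. -/
theorem abs_sum_node_le (htop : ∀ t, W t / 2 ^ m = top) (htotal : |∑ t, χ t| ≤ T)
    (hcoeff : ∀ i < m, ∀ v, |∑ t, χ t * if W t / 2 ^ (i + 1) = v then bitSign (W t) i else 0| ≤ T)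
    {j k : ℕ} (hj : j + k = m) (u : ℕ) :
    |∑ t, if W t / 2 ^ j = u then χ t else 0| ≤ T := by
  have hT : 0 ≤ T := (abs_nonneg _).trans htotal
  induction k generalizing j u with
  | zero =>
    obtain rfl : j = m := hj
    simp only [htop]
    split_ifs
    · exact htotal
    · simpa using hT
  | succ k ih =>
    have h1 := ih (j := j + 1) (by omega) (u / 2)
    have h2 := hcoeff j (by omega) (u / 2)
    have h3 : 2 * (∑ t, if W t / 2 ^ j = u then χ t else 0) =
        (∑ t, if W t / 2 ^ (j + 1) = u / 2 then χ t else 0) + (if u % 2 = 0 then 1 else -1) *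
          ∑ t, χ t * if W t / 2 ^ (j + 1) = u / 2 then bitSign (W t) j else 0 := by
      rw [Finset.mul_sum, Finset.mul_sum, ← Finset.sum_add_distrib]
      refine Finset.sum_congr rfl fun t _ => ?_
      rw [pow_succ, ← Nat.div_div_eq_div_mul, bitSign]
      generalize W t / 2 ^ j = a
      split_ifs <;> omega
    rw [abs_le] at h1 h2 ⊢
    split_ifs at h3 <;> constructor <;> linarith

/-- Passing to the next finer level adds the single node `u - 1` if `u` is odd and nothing if `u` is
even; so a prefix consists of at most one node per level. -/
theorem abs_sum_prefix_le (htop : ∀ t, W t / 2 ^ m = top) (htotal : |∑ t, χ t| ≤ T)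
    (hcoeff : ∀ i < m, ∀ v, |∑ t, χ t * if W t / 2 ^ (i + 1) = v then bitSign (W t) i else 0| ≤ T)
    {j k : ℕ} (hj : j + k = m) (u : ℕ) :
    |∑ t, if W t / 2 ^ j < u then χ t else 0| ≤ (k + 1) * T := by
  have hT : 0 ≤ T := (abs_nonneg _).trans htotal
  induction k generalizing j u with
  | zero =>
    obtain rfl : j = m := hj
    simp only [htop]
    split_ifs
    · simpa using htotal
    · simpa using hT
  | succ k ih =>
    have h1 := ih (j := j + 1) (by omega) (u / 2)
    have h2 := abs_sum_node_le htop htotal hcoeff hj (u - 1)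
    have h3 : (∑ t, if W t / 2 ^ j < u then χ t else 0) =
        (∑ t, if W t / 2 ^ (j + 1) < u / 2 then χ t else 0) + if u % 2 = 1 then
          ∑ t, (if W t / 2 ^ j = u - 1 then χ t else 0) else 0 := by
      split_ifs with hu
      · rw [← Finset.sum_add_distrib]
        refine Finset.sum_congr rfl fun t _ => ?_
        rw [pow_succ, ← Nat.div_div_eq_div_mul]
        generalize W t / 2 ^ j = a
        split_ifs <;> omega
      · rw [add_zero]
        refine Finset.sum_congr rfl fun t _ => ?_
        rw [pow_succ, ← Nat.div_div_eq_div_mul]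
        generalize W t / 2 ^ j = a
        split_ifs <;> omega
    rw [h3]
    refine (abs_add_le _ _).trans ?_
    have h4 : |if u % 2 = 1 then ∑ t, (if W t / 2 ^ j = u - 1 then χ t else 0) else 0| ≤ T := by
      split_ifs
      · exact h2
      · simpa using hT
    push_cast
    linarith

/-- The interval is compared with the leaves from that of `a` up to, but excluding, that of `b`.
Only points in these two leaves can be miscounted. -/
theorem abs_sum_Icc_le {x : Fin n → ℝ} {R : ℕ} (hχ : ∀ t, |χ t| = 1)
    (htop : ∀ t, (top * 2 ^ m + ⌊x t * 2 ^ m⌋₊) / 2 ^ m = top) (htotal : |∑ t, χ t| ≤ T)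
    (hcoeff : ∀ i < m, ∀ v, |∑ t, χ t * if (top * 2 ^ m + ⌊x t * 2 ^ m⌋₊) / 2 ^ (i + 1) = v
      then bitSign (top * 2 ^ m + ⌊x t * 2 ^ m⌋₊) i else 0| ≤ T)
    (hcount : ∀ w, (Finset.univ.filter fun t => top * 2 ^ m + ⌊x t * 2 ^ m⌋₊ = w).card ≤ R)
    (a b : ℝ) (hab : a < b) :
    |∑ t, if a ≤ x t ∧ x t ≤ b then χ t else 0| ≤ 2 * (m + 1) * T + 2 * R := by
  set W : Fin n → ℕ := fun t => top * 2 ^ m + ⌊x t * 2 ^ m⌋₊ with hW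
  set A := top * 2 ^ m + ⌊a * 2 ^ m⌋₊ with hA
  set B := top * 2 ^ m + ⌊b * 2 ^ m⌋₊ with hB
  have hpow : (0 : ℝ) < 2 ^ m := by positivity
  have hAB : A ≤ B := by
    have : ⌊a * 2 ^ m⌋₊ ≤ ⌊b * 2 ^ m⌋₊ := Nat.floor_le_floor (by gcongr)
    omega
  have key : ∀ y z : ℝ, top * 2 ^ m + ⌊y * 2 ^ m⌋₊ < top * 2 ^ m + ⌊z * 2 ^ m⌋₊ → y < z := by
    intro y z h
    by_contra hyz
    have : ⌊z * 2 ^ m⌋₊ ≤ ⌊y * 2 ^ m⌋₊ := Nat.floor_le_floor (by gcongr; exact not_lt.1 hyz)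
    omega
  have hF : ∀ u, |∑ t, if W t < u then χ t else 0| ≤ (m + 1) * T := by
    intro u
    simpa using abs_sum_prefix_le htop htotal hcoeff (zero_add m) u
  have hN : ∀ u, ∑ t, (if W t = u then (1 : ℤ) else 0) ≤ R := by
    intro u
    rw [Finset.sum_boole]
    have := hcount u
    simp only [Nat.cast_le]
    exact this
  have hpt : ∀ t, |(if a ≤ x t ∧ x t ≤ b then χ t else 0) -
      ((if W t < B then χ t else 0) - if W t < A then χ t else 0)| ≤
      (if W t = A then 1 else 0) + if W t = B then 1 else 0 := by
    intro t
    have h1 := hχ t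
    have k1 : W t < A → x t < a := key _ _
    have k2 : A < W t → a < x t := key _ _
    have k3 : W t < B → x t < b := key _ _
    have k4 : B < W t → b < x t := key _ _
    rcases lt_trichotomy (W t) A with h | h | h
    · rw [if_neg fun h' => (k1 h).not_ge h'.1, if_pos h, if_pos (h.trans_le hAB)]
      simp
      split_ifs <;> simp
    · rw [if_neg (by omega : ¬ W t < A), if_pos h]
      split_ifs <;> simp [h1]
    · rw [if_neg (by omega : ¬ W t < A), if_neg (by omega : ¬ W t = A)]
      rcases lt_trichotomy (W t) B with h' | h' | h'
      · rw [if_pos ⟨(k2 h).le, (k3 h').le⟩, if_pos h', if_neg h'.ne]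
        simp
      · rw [if_neg (by omega : ¬ W t < B), if_pos h']
        split_ifs <;> simp [h1]
      · rw [if_neg fun h'' => (k4 h').not_ge h''.2, if_neg (by omega : ¬ W t < B),
          if_neg h'.ne']
        simp
  have hsum : |∑ t, (if a ≤ x t ∧ x t ≤ b then χ t else 0) -
      ((∑ t, if W t < B then χ t else 0) - ∑ t, if W t < A then χ t else 0)| ≤ 2 * R := by
    rw [← Finset.sum_sub_distrib, ← Finset.sum_sub_distrib]
    refine (Finset.abs_sum_le_sum_abs _ _).trans ((Finset.sum_le_sum fun t _ => hpt t).trans ?_)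
    rw [Finset.sum_add_distrib]
    linarith [hN A, hN B]
  have hFA := abs_le.1 (hF A)
  have hFB := abs_le.1 (hF B)
  have hS := abs_le.1 hsum
  rw [abs_le]
  constructor <;> linarith

end Prefix

end Haar

namespace StripeAlg

open Haar

theorem abs_color (A : OnlineAlg) {n : ℕ} (p : Fin n → ℝ × ℝ) (t : Fin n) : |A.color p t| = 1 := by
  unfold OnlineAlg.color
  split_ifs <;> simp

theorem stripeDisc_le {n T R : ℕ} (hn : 2 ≤ n) {p : Fin n → ℝ × ℝ}
    (hp : ∀ t, (p t).1 ∈ Ico (0 : ℝ) 1 ∧ (p t).2 ∈ Ico (0 : ℝ) 1)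
    (hT : ∀ v < 2 ^ (Nat.clog 2 n + 1),
      |run (Nat.clog 2 n) 0 (List.ofFn fun t => cell (Nat.clog 2 n) (p t)) v| ≤ (T : ℤ))
    (hX : ∀ w, (Finset.univ.filter fun t => (cell (Nat.clog 2 n) (p t)).1 = w).card ≤ R)
    (hY : ∀ w, (Finset.univ.filter fun t => (cell (Nat.clog 2 n) (p t)).2 = w).card ≤ R) :
    stripeDisc p (alg.color p) ≤ 2 * (Nat.clog 2 n + 1) * T + 2 * R := by
  set m := Nat.clog 2 n with hm
  have hmem : ∀ t, cell m (p t) ∈ cells m := fun t => cell_mem_cells (hp t).1 (hp t).2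
  have hcoeff : ∀ l ∈ levels m, ∀ v, |∑ t, alg.color p t *
      if node l (cell m (p t)) = v then side l (cell m (p t)) else 0| ≤ (T : ℤ) := by
    intro l hl v
    by_cases h : ∃ t, node l (cell m (p t)) = v
    · obtain ⟨s, rfl⟩ := h
      have := hT (node l (cell m (p s))) (node_lt (hmem s))
      rw [run_eq_sum hn hp] at this
      simpa only [← hm, haar_node hl (hmem _) (hmem s)] using this
    · push Not at h
      simp [h]
  -- Every first leaf lies below node `2`, so the function of the root `1` is constantly `1` and its
  -- coefficient is the total imbalance.
  have htotal : |∑ t, alg.color p t| ≤ (T : ℤ) := by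
    have := hcoeff (.inl m) (by simp [levels]) 1
    have h2 : ∀ t, (if node (.inl m) (cell m (p t)) = 1 then side (.inl m) (cell m (p t)) else 0)
        = 1 := by
      intro t
      have h := (mem_cells.1 (hmem t)).1
      simp [node, side, bitSign, pow_succ, ← Nat.div_div_eq_div_mul, h]
    simpa only [h2, mul_one] using this
  have hcX := abs_sum_Icc_le (top := 2) (m := m) (x := fun t => (p t).1) (abs_color alg p)
    (fun t => (mem_cells.1 (hmem t)).1) htotal
    (fun i hi v => hcoeff (.inl i) (by simp [levels]; omega) v) hX
  have hcY := abs_sum_Icc_le (top := 3) (m := m) (x := fun t => (p t).2) (abs_color alg p)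
    (fun t => (mem_cells.1 (hmem t)).2) htotal
    (fun i hi v => hcoeff (.inr i) (by simp [levels]; omega) v) hY
  have : Nonempty stripes :=
    ⟨⟨Icc 0 1 ×ˢ Icc 0 1, 0, 1, le_rfl, zero_lt_one, le_rfl, .inl rfl⟩⟩
  refine ciSup_le ?_
  rintro ⟨S, a, b, -, hab, -, rfl | rfl⟩
  · have h : imbalance p (alg.color p) (Icc a b ×ˢ Icc 0 1) =
        ∑ t, if a ≤ (p t).1 ∧ (p t).1 ≤ b then alg.color p t else 0 := by
      refine Finset.sum_congr rfl fun t _ => ?_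
      have h2 := (hp t).2
      simp only [mem_prod, mem_Icc, h2.1, h2.2.le, and_self, and_true]
    have := hcX a b hab
    rw [← h] at this
    simp only
    exact_mod_cast this
  · have h : imbalance p (alg.color p) (Icc 0 1 ×ˢ Icc a b) =
        ∑ t, if a ≤ (p t).2 ∧ (p t).2 ≤ b then alg.color p t else 0 := by
      refine Finset.sum_congr rfl fun t _ => ?_
      have h2 := (hp t).1
      simp only [mem_prod, mem_Icc, h2.1, h2.2.le, and_self, true_and]
    have := hcY a b hab
    rw [← h] at this
    simp only
    exact_mod_cast this

end StripeAlg

/-! ### The bad events -/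

namespace Haar

/-- The sequences of cells with a large Haar coefficient. -/
noncomputable def badCoeff (n m T : ℕ) : Finset (Fin n → cells m) :=
  Finset.univ.filter fun c => ∃ v < 2 ^ (m + 1),
    (T : ℤ) < |run m 0 (List.ofFn fun t => (c t : ℕ × ℕ)) v|

/-- The sequences of cells that often visit the same leaf of a tree. -/
def badLeaf (n m R : ℕ) (π : ℕ × ℕ → ℕ) (I : Finset ℕ) : Finset (Fin n → cells m) :=
  I.biUnion fun w => Finset.univ.filter fun c =>
    R ≤ (Finset.univ.filter fun t => π (c t) = w).card

/-- Bernoulli's inequality. A threshold of order `m ^ 2` therefore beats any fixed power of `2 ^ m`.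
-/
theorem two_le_base_pow {m : ℕ} (hm : 0 < m) : 2 ≤ base m ^ m := by
  have h0 : (0 : ℝ) < m := by positivity
  have h1 : 0 < 1 / (m : ℝ) := by positivity
  have h := one_add_mul_le_pow (a := 1 / (m : ℝ)) (by linarith) m
  have e : 1 + 1 / (m : ℝ) = base m := by
    rw [base]
    field_simp
  rw [e, mul_one_div_cancel h0.ne'] at h
  linarith

/-- With `Q = 2 ^ m`, the potential starts at `4 * Q` and drifts by at most `2 * n ≤ 2 * Q`, while
the threshold makes `base m ^ T ≥ Q ^ (k + 4)`. -/
theorem card_badCoeff_le {n m : ℕ} (hm : 0 < m) (hn : n ≤ 2 ^ m) (k : ℕ) :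
    ((badCoeff n m (m * (m * (k + 4)))).card : ℝ) ≤
      (cells m).card ^ n * (6 / (2 ^ m) ^ (k + 3)) := by
  have h := card_exists_lt_abs_run_le hm n (m * (m * (k + 4)))
  set Q : ℝ := 2 ^ m with hQ
  have hQ0 : 0 < Q := by positivity
  have hnQ : (n : ℝ) ≤ Q := by
    rw [hQ]
    exact_mod_cast hn
  have h1 : Q ^ (k + 4) ≤ base m ^ (m * (m * (k + 4))) := by
    rw [pow_mul, hQ, ← pow_mul]
    exact pow_le_pow_left₀ (by norm_num) (two_le_base_pow hm) _
  have h2 : ((badCoeff n m (m * (m * (k + 4)))).card : ℝ) * Q ^ (k + 4) ≤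
      (cells m).card ^ n * (6 * Q) := by
    refine (mul_le_mul_of_nonneg_left h1 (by positivity)).trans (h.trans ?_)
    gcongr
    rw [pow_succ]
    linarith
  rw [← le_div_iff₀ (by positivity)] at h2
  refine h2.trans (le_of_eq ?_)
  rw [pow_succ]
  field_simp

/-- A leaf has probability at most `1 / Q`, so the exponential moment of its visits is at most `(1 +
1 / Q) ^ n ≤ e`. The threshold contributes `Q ^ (k + 4)`, and the union over `Q` leaves costs one
factor `Q`. -/
theorem card_badLeaf_le {n m : ℕ} (hn : n ≤ 2 ^ m) (k : ℕ) (π : ℕ × ℕ → ℕ) (I : Finset ℕ)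
    (hI : I.card = 2 ^ m)
    (hπ : ∀ w, (Finset.univ.filter fun z : cells m => π z = w).card ≤ 2 ^ m) :
    ((badLeaf n m (m * (k + 4)) π I).card : ℝ) ≤ (cells m).card ^ n * (3 / (2 ^ m) ^ (k + 3)) := by
  set Q : ℝ := 2 ^ m with hQ
  have hQ0 : 0 < Q := by positivity
  have hnQ : (n : ℝ) ≤ Q := by
    rw [hQ]
    exact_mod_cast hn
  have hZ : ((cells m).card : ℝ) = Q * Q := by
    rw [card_cells]
    push_cast
    rfl
  have hexp : (1 + 1 / Q) ^ n ≤ 3 := by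
    calc (1 + 1 / Q) ^ n ≤ Real.exp (1 / Q) ^ n := by
          gcongr
          linarith [Real.add_one_le_exp (1 / Q)]
      _ = Real.exp (n / Q) := by
          rw [← Real.exp_nat_mul]
          congr 1
          ring
      _ ≤ Real.exp 1 := Real.exp_le_exp.2 (by rwa [div_le_one hQ0])
      _ ≤ 3 := Real.exp_one_lt_three.le
  have hone : ∀ w ∈ I, ((Finset.univ.filter fun c : Fin n → cells m =>
      m * (k + 4) ≤ (Finset.univ.filter fun t => π (c t) = w).card).card : ℝ) ≤
      (cells m).card ^ n * (3 / Q ^ (k + 4)) := by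
    intro w _
    have h := card_le_card_filter_mul_two_pow_le (α := cells m) n (m * (k + 4)) fun z => π z = w
    have h' := h.trans (Nat.pow_le_pow_left (Nat.add_le_add_left (hπ w) _) n)
    rw [Fintype.card_coe] at h'
    have h2 : ((Finset.univ.filter fun c : Fin n → cells m =>
        m * (k + 4) ≤ (Finset.univ.filter fun t => π (c t) = w).card).card : ℝ) * Q ^ (k + 4) ≤
        ((cells m).card + Q) ^ n := by
      rw [hQ, ← pow_mul]
      exact_mod_cast h'
    have h3 : ((cells m).card + Q) ^ n = (cells m).card ^ n * (1 + 1 / Q) ^ n := by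
      rw [← mul_pow, hZ]
      congr 1
      field_simp
    rw [h3, ← le_div_iff₀ (by positivity)] at h2
    refine h2.trans ?_
    rw [mul_div_assoc]
    gcongr
  calc ((badLeaf n m (m * (k + 4)) π I).card : ℝ)
      ≤ ∑ w ∈ I, ((Finset.univ.filter fun c : Fin n → cells m =>
          m * (k + 4) ≤ (Finset.univ.filter fun t => π (c t) = w).card).card : ℝ) := by
        exact_mod_cast Finset.card_biUnion_le
    _ ≤ I.card • ((cells m).card ^ n * (3 / Q ^ (k + 4)) : ℝ) := Finset.sum_le_card_nsmul _ _ _ hone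
    _ = _ := by
        rw [hI, nsmul_eq_mul, pow_succ Q (k + 3)]
        push_cast
        rw [← hQ]
        field_simp

theorem card_fst_fiber_le (m w : ℕ) :
    (Finset.univ.filter fun z : cells m => (z : ℕ × ℕ).1 = w).card ≤ 2 ^ m := by
  calc _ ≤ (Finset.Ico (3 * 2 ^ m) (4 * 2 ^ m)).card := by
        refine Finset.card_le_card_of_injOn (fun z => (z : ℕ × ℕ).2) ?_ ?_
        · intro z _
          exact (Finset.mem_product.1 z.2).2
        · intro z hz z' hz' h
          simp only [Finset.coe_filter, Finset.mem_univ, true_and, mem_ofPred_eq] at hz hz'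
          exact Subtype.ext (Prod.ext (hz.trans hz'.symm) h)
    _ = 2 ^ m := by
        rw [Nat.card_Ico]
        omega

theorem card_snd_fiber_le (m w : ℕ) :
    (Finset.univ.filter fun z : cells m => (z : ℕ × ℕ).2 = w).card ≤ 2 ^ m := by
  calc _ ≤ (Finset.Ico (2 * 2 ^ m) (3 * 2 ^ m)).card := by
        refine Finset.card_le_card_of_injOn (fun z => (z : ℕ × ℕ).1) ?_ ?_
        · intro z _
          exact (Finset.mem_product.1 z.2).1
        · intro z hz z' hz' h
          simp only [Finset.coe_filter, Finset.mem_univ, true_and, mem_ofPred_eq] at hz hz'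
          exact Subtype.ext (Prod.ext h (hz.trans hz'.symm))
    _ = 2 ^ m := by
        rw [Nat.card_Ico]
        omega

/-- The sequences of cells for which the discrepancy may be large. -/
noncomputable def bad (n m k : ℕ) : Finset (Fin n → cells m) :=
  badCoeff n m (m * (m * (k + 4))) ∪
    (badLeaf n m (m * (k + 4)) Prod.fst (Finset.Ico (2 * 2 ^ m) (3 * 2 ^ m)) ∪
      badLeaf n m (m * (k + 4)) Prod.snd (Finset.Ico (3 * 2 ^ m) (4 * 2 ^ m)))

theorem card_bad_le {n m : ℕ} (hn3 : 3 ≤ n) (hm : 0 < m) (hn : n ≤ 2 ^ m) (k : ℕ) :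
    ((bad n m k).card : ℝ) ≤ (cells m).card ^ n * (1 / (n : ℝ) ^ k) := by
  have h1 := card_badCoeff_le hm hn k
  have h2 := card_badLeaf_le hn k Prod.fst (Finset.Ico (2 * 2 ^ m) (3 * 2 ^ m))
    (by rw [Nat.card_Ico]; omega) (card_fst_fiber_le m)
  have h3 := card_badLeaf_le hn k Prod.snd (Finset.Ico (3 * 2 ^ m) (4 * 2 ^ m))
    (by rw [Nat.card_Ico]; omega) (card_snd_fiber_le m)
  have h4 : ((bad n m k).card : ℝ) ≤ (badCoeff n m (m * (m * (k + 4)))).card +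
      ((badLeaf n m (m * (k + 4)) Prod.fst (Finset.Ico (2 * 2 ^ m) (3 * 2 ^ m))).card +
        (badLeaf n m (m * (k + 4)) Prod.snd (Finset.Ico (3 * 2 ^ m) (4 * 2 ^ m))).card) := by
    have ha := Finset.card_union_le (badCoeff n m (m * (m * (k + 4))))
      (badLeaf n m (m * (k + 4)) Prod.fst (Finset.Ico (2 * 2 ^ m) (3 * 2 ^ m)) ∪
        badLeaf n m (m * (k + 4)) Prod.snd (Finset.Ico (3 * 2 ^ m) (4 * 2 ^ m)))
    have hb := Finset.card_union_le
      (badLeaf n m (m * (k + 4)) Prod.fst (Finset.Ico (2 * 2 ^ m) (3 * 2 ^ m)))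
      (badLeaf n m (m * (k + 4)) Prod.snd (Finset.Ico (3 * 2 ^ m) (4 * 2 ^ m)))
    unfold bad
    exact_mod_cast ha.trans (Nat.add_le_add_left hb _)
  set Q : ℝ := 2 ^ m with hQ
  have hnQ : (n : ℝ) ≤ Q := by
    rw [hQ]
    exact_mod_cast hn
  have hn3' : (3 : ℝ) ≤ n := by exact_mod_cast hn3
  -- Here `12 = 6 + 3 + 3`; the three spare factors `Q ≥ 3` absorb it.
  have h5 : 12 / Q ^ (k + 3) ≤ 1 / (n : ℝ) ^ k := by
    rw [div_le_div_iff₀ (by positivity) (by positivity), one_mul, pow_add, mul_comm]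
    gcongr
    calc (12 : ℝ) ≤ 3 ^ 3 := by norm_num
      _ ≤ Q ^ 3 := by
        gcongr
        linarith
  calc _ ≤ (cells m).card ^ n * (12 / Q ^ (k + 3)) := by
        refine h4.trans ((add_le_add h1 (add_le_add h2 h3)).trans (le_of_eq ?_))
        ring
    _ ≤ _ := by gcongr

end Haar

/-! ### Uniform points -/

namespace StripeAlg

open Haar

theorem volume_cell_fiber_le (m : ℕ) (z : ℕ × ℕ) :
    ((volume : Measure (ℝ × ℝ)).restrict (Icc 0 1 ×ˢ Icc 0 1))
      {q | q.1 ∈ Ico (0 : ℝ) 1 ∧ q.2 ∈ Ico (0 : ℝ) 1 ∧ cell m q = z} ≤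
      ENNReal.ofReal (1 / (cells m).card) := by
  have hpow : (0 : ℝ) < 2 ^ m := by positivity
  have key : ∀ x : ℝ, 0 ≤ x → ∀ a b : ℕ, b + ⌊x * 2 ^ m⌋₊ = a →
      x ∈ Ico (((a - b : ℕ) : ℝ) / 2 ^ m) (((a - b : ℕ) + 1 : ℝ) / 2 ^ m) := by
    rintro x hx a b rfl
    rw [Nat.add_sub_cancel_left, mem_Ico, div_le_iff₀ hpow, lt_div_iff₀ hpow]
    exact ⟨Nat.floor_le (by positivity), Nat.lt_floor_add_one _⟩
  calc _ ≤ (volume : Measure (ℝ × ℝ)) (Ico (((z.1 - 2 * 2 ^ m : ℕ) : ℝ) / 2 ^ m)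
        (((z.1 - 2 * 2 ^ m : ℕ) + 1 : ℝ) / 2 ^ m) ×ˢ Ico (((z.2 - 3 * 2 ^ m : ℕ) : ℝ) / 2 ^ m)
        (((z.2 - 3 * 2 ^ m : ℕ) + 1 : ℝ) / 2 ^ m)) := by
        refine (Measure.restrict_apply_le _ _).trans (measure_mono ?_)
        rintro q ⟨h1, h2, rfl⟩
        exact ⟨key _ h1.1 _ _ rfl, key _ h2.1 _ _ rfl⟩
    _ = ENNReal.ofReal (1 / 2 ^ m) * ENNReal.ofReal (1 / 2 ^ m) := by
        rw [Measure.volume_eq_prod, Measure.prod_prod, Real.volume_Ico, Real.volume_Ico]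
        congr 2 <;> ring
    _ = _ := by
        rw [← ENNReal.ofReal_mul (by positivity), card_cells]
        congr 1
        push_cast
        field_simp

/-- A coordinate equal to `1` would fall beyond the last leaf; such points form a null set. -/
theorem ae_mem_Ico (n : ℕ) :
    ∀ᵐ p ∂uniformPoints n, ∀ t, (p t).1 ∈ Ico (0 : ℝ) 1 ∧ (p t).2 ∈ Ico (0 : ℝ) 1 := by
  have h1 : ∀ᵐ q ∂((volume : Measure (ℝ × ℝ)).restrict (Icc 0 1 ×ˢ Icc 0 1)),
      q.1 ∈ Ico (0 : ℝ) 1 ∧ q.2 ∈ Ico (0 : ℝ) 1 := by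
    have e : Icc (0 : ℝ) 1 ×ˢ Icc (0 : ℝ) 1 =ᵐ[volume] Ico (0 : ℝ) 1 ×ˢ Ico (0 : ℝ) 1 := by
      rw [Measure.volume_eq_prod]
      exact (Measure.set_prod_ae_eq Ico_ae_eq_Icc Ico_ae_eq_Icc).symm
    rw [Measure.restrict_congr_set e]
    filter_upwards [ae_restrict_mem (measurableSet_Ico.prod measurableSet_Ico)] with q hq
    exact hq
  rw [Filter.eventually_all]
  intro t
  exact (Measure.tendsto_eval_ae_ae
    (μ := fun _ : Fin n => (volume : Measure (ℝ × ℝ)).restrict (Icc 0 1 ×ˢ Icc 0 1))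
    (i := t)).eventually h1

/-- Transfers counting to probability: each cell sequence has probability at most `1 / (cells
m).card ^ n`. The union bound works with outer measure, so the measurability of the event plays no
role. -/
theorem uniformPoints_cell_mem_le {n : ℕ} (m : ℕ) (B : Finset (Fin n → cells m)) :
    uniformPoints n {p | (∀ t, (p t).1 ∈ Ico (0 : ℝ) 1 ∧ (p t).2 ∈ Ico (0 : ℝ) 1) ∧
      ∃ c ∈ B, ∀ t, cell m (p t) = c t} ≤
      ENNReal.ofReal (B.card / (cells m).card ^ n) := by
  calc _ ≤ uniformPoints n (⋃ c ∈ B, univ.pi fun t =>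
        {q | q.1 ∈ Ico (0 : ℝ) 1 ∧ q.2 ∈ Ico (0 : ℝ) 1 ∧ cell m q = c t}) := by
        refine measure_mono ?_
        rintro p ⟨hp, c, hc, h⟩
        simp only [mem_iUnion, mem_univ_pi]
        exact ⟨c, hc, fun t => ⟨(hp t).1, (hp t).2, h t⟩⟩
    _ ≤ ∑ c ∈ B, uniformPoints n (univ.pi fun t =>
        {q | q.1 ∈ Ico (0 : ℝ) 1 ∧ q.2 ∈ Ico (0 : ℝ) 1 ∧ cell m q = c t}) :=
        measure_biUnion_finset_le _ _
    _ ≤ ∑ c ∈ B, ENNReal.ofReal (1 / (cells m).card) ^ n := by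
        refine Finset.sum_le_sum fun c _ => ?_
        rw [uniformPoints, Measure.pi_pi]
        refine (Finset.prod_le_prod' fun t _ => volume_cell_fiber_le m (c t)).trans ?_
        simp
    _ = _ := by
        rw [Finset.sum_const, nsmul_eq_mul, ← ENNReal.ofReal_pow (by positivity),
          ← ENNReal.ofReal_natCast, ← ENNReal.ofReal_mul (by positivity)]
        congr 1
        rw [one_div, inv_pow]
        rfl

/-- The discrepancy of the algorithm is polylogarithmic with high probability. -/
theorem uniformPoints_stripeDisc_le {n : ℕ} (hn : 3 ≤ n) (k : ℕ) :
    uniformPoints n {p | 6 * (k + 4) * (Nat.clog 2 n : ℝ) ^ 3 < stripeDisc p (alg.color p)} ≤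
      ENNReal.ofReal (1 / (n : ℝ) ^ k) := by
  set m := Nat.clog 2 n with hm
  have hm0 : 0 < m := Nat.clog_pos (by norm_num) (by omega)
  have hnm : n ≤ 2 ^ m := Nat.le_pow_clog (by norm_num) n
  have hm1 : (1 : ℝ) ≤ m := by exact_mod_cast hm0
  have hdet : ∀ p : Fin n → ℝ × ℝ, (∀ t, (p t).1 ∈ Ico (0 : ℝ) 1 ∧ (p t).2 ∈ Ico (0 : ℝ) 1) →
      6 * (k + 4) * (m : ℝ) ^ 3 < stripeDisc p (alg.color p) →
      ∃ c ∈ bad n m k, ∀ t, cell m (p t) = c t := by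
    intro p hp hdisc
    have hmem : ∀ t, cell m (p t) ∈ cells m := fun t => cell_mem_cells (hp t).1 (hp t).2
    refine ⟨fun t => ⟨cell m (p t), hmem t⟩, ?_, fun t => rfl⟩
    by_contra hbad
    simp only [bad, badCoeff, badLeaf, Finset.mem_union, Finset.mem_biUnion, Finset.mem_filter,
      Finset.mem_univ, true_and, not_or, not_exists, not_and, not_lt, not_le] at hbad
    obtain ⟨b1, b2, b3⟩ := hbad
    have hX : ∀ w, (Finset.univ.filter fun t => (cell m (p t)).1 = w).card ≤ m * (k + 4) := by
      intro w
      by_cases hw : w ∈ Finset.Ico (2 * 2 ^ m) (3 * 2 ^ m)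
      · exact (b2 w hw).le
      · rw [Finset.filter_false_of_mem]
        · simp
        · rintro t _ rfl
          exact hw (Finset.mem_product.1 (hmem t)).1
    have hY : ∀ w, (Finset.univ.filter fun t => (cell m (p t)).2 = w).card ≤ m * (k + 4) := by
      intro w
      by_cases hw : w ∈ Finset.Ico (3 * 2 ^ m) (4 * 2 ^ m)
      · exact (b3 w hw).le
      · rw [Finset.filter_false_of_mem]
        · simp
        · rintro t _ rfl
          exact hw (Finset.mem_product.1 (hmem t)).2
    have h := stripeDisc_le (by omega) hp b1 hX hY
    rw [← hm] at h
    push_cast at h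
    have h2 : 2 * ((m : ℝ) + 1) * (m * (m * (k + 4))) + 2 * (m * (k + 4)) ≤
        6 * (k + 4) * (m : ℝ) ^ 3 := by
      have : (m : ℝ) ≤ m ^ 2 := by nlinarith
      have : (m : ℝ) ^ 2 ≤ m ^ 3 := by nlinarith [sq_nonneg (m : ℝ)]
      have hk : (0 : ℝ) ≤ k + 4 := by positivity
      have h3 : 2 * (m : ℝ) ^ 3 + 2 * m ^ 2 + 2 * m ≤ 6 * m ^ 3 := by linarith
      calc _ = (k + 4) * (2 * (m : ℝ) ^ 3 + 2 * m ^ 2 + 2 * m) := by ring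
        _ ≤ (k + 4) * (6 * m ^ 3) := mul_le_mul_of_nonneg_left h3 hk
        _ = _ := by ring
    linarith
  refine (measure_mono_ae ?_).trans ((uniformPoints_cell_mem_le m (bad n m k)).trans ?_)
  · filter_upwards [ae_mem_Ico n] with p hp h
    exact ⟨hp, hdet p hp h⟩
  · apply ENNReal.ofReal_le_ofReal
    have hc : (0 : ℝ) < (cells m).card := by
      rw [card_cells]
      positivity
    rw [div_le_iff₀ (by positivity), mul_comm]
    exact card_bad_le hn hm0 hnm k

/-! ### Comparison of a power of the logarithm with the stated bound. -/

theorem clog_two_le_three_mul_log {n : ℕ} (hn : 3 ≤ n) : (Nat.clog 2 n : ℝ) ≤ 3 * Real.log n := by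
  set m := Nat.clog 2 n with hm
  have hn3 : (3 : ℝ) ≤ n := by exact_mod_cast hn
  have hm0 : 0 < m := Nat.clog_pos (by norm_num) (by omega)
  have h1 : 2 ^ (m - 1) < n := Nat.pow_pred_clog_lt_self (by norm_num) (by omega)
  have h2 : (2 : ℝ) ^ (m - 1) ≤ n := by exact_mod_cast h1.le
  have h3 := Real.log_le_log (by positivity) h2
  rw [Real.log_pow, Nat.cast_sub hm0, Nat.cast_one] at h3
  have h4 : 1 ≤ Real.log n := by
    rw [Real.le_log_iff_exp_le (by linarith)]
    linarith [Real.exp_one_lt_three]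
  have h5 := Real.log_two_gt_d9
  have h6 : (1 : ℝ) ≤ m := by exact_mod_cast hm0
  nlinarith

/-- With `y = log n`, taking logarithms leaves `3 * (log y) ^ 2 ≤ 12 * y`, which follows from `log y
≤ 2 * √y`; hence the constant `12`. As `n ≥ 3 > e`, `log y` is positive. -/
theorem log_pow_three_le_rpow {n : ℕ} (hn : 3 ≤ n) :
    Real.log n ^ 3 ≤ (n : ℝ) ^ (12 / Real.log (Real.log n)) := by
  have hn3 : (3 : ℝ) ≤ n := by exact_mod_cast hn
  set y := Real.log n with hy
  have hy1 : 1 < y := by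
    rw [hy, Real.lt_log_iff_exp_lt (by linarith)]
    linarith [Real.exp_one_lt_three]
  have hl : 0 < Real.log y := Real.log_pos hy1
  rw [Real.rpow_def_of_pos (by linarith), ← hy]
  have h1 : y ^ 3 = Real.exp (3 * Real.log y) := by
    rw [mul_comm, Real.exp_mul, Real.exp_log (by linarith)]
    norm_cast
  rw [h1, Real.exp_le_exp, mul_div_assoc', le_div_iff₀ hl]
  have h2 : Real.log y ≤ 2 * √y := by
    have := Real.log_le_sub_one_of_pos (Real.sqrt_pos.2 (by linarith : 0 < y))
    rw [Real.log_sqrt (by linarith)] at this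
    linarith
  have h3 : √y * √y = y := Real.mul_self_sqrt (by linarith)
  nlinarith

end StripeAlg

theorem theorem2 :
    ∃ A : OnlineAlg, A.IsPolyTime ∧
      ∃ c : ℝ, 0 < c ∧ ∀ k : ℕ, ∃ C : ℝ, 0 < C ∧ ∀ n : ℕ, 3 ≤ n →
        uniformPoints n
            {p | C * (n : ℝ) ^ (c / Real.log (Real.log n)) < stripeDisc p (A.color p)} ≤
          ENNReal.ofReal (1 / (n : ℝ) ^ k) := by
  -- The factor `27` is the cube of the `3` in `clog_two_le_three_mul_log`.
  refine ⟨StripeAlg.alg, StripeAlg.alg_isPolyTime, 12, by norm_num, fun k =>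
    ⟨6 * (k + 4) * 27, by positivity, fun n hn => ?_⟩⟩
  refine (measure_mono fun p hp => ?_).trans (StripeAlg.uniformPoints_stripeDisc_le hn k)
  rw [mem_ofPred_eq] at hp ⊢
  refine lt_of_le_of_lt ?_ hp
  have h1 := StripeAlg.clog_two_le_three_mul_log hn
  have h2 := StripeAlg.log_pow_three_le_rpow hn
  calc 6 * (k + 4) * (Nat.clog 2 n : ℝ) ^ 3 ≤ 6 * (k + 4) * (3 * Real.log n) ^ 3 := by gcongr
    _ = 6 * (k + 4) * 27 * Real.log n ^ 3 := by ring
    _ ≤ _ := by gcongr
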